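/- **Model.** There are $p$ cores and discrete time. Memory is divided into blocks of $B\ge 1$ words. A computation step without memory access takes one time unit, and $b\ge 1$ bounds the delay of a cache miss. Accesses to a block that is written by other cores may be delayed arbitrarily, subject only to this: an access of a core $c$ to a block $\beta$ is not delayed during $b$ consecutive time units unless some other core completes a write into $\beta$ in that time. **BP computations.** Fix constants $K\in\mathbb N$, $0<\alpha<1$ and $0<c_1\le 1\le c_2$. A *(limited-access) balanced parallel (BP) computation* is given by a finite rooted binary tree, in which every node has two children or none, and which is traversed by a down-pass (each inner node forks its two children) followed by an up-pass (each inner node continues when both children are completed). It satisfies: * every node performs at least one and at most $K$ operations in the down-pass and in the up-pass, and declares at most $K$ local variables; in the down-pass it may access its own local variables, those of its ancestors, and global words; * every variable that is written is accessed at most $K$ times in total; * every node $v$ (the root of the task $\tau_v$, the computation of its subtree) has a size $|\tau_v|\ge 1$, an upper bound on the number of words that $\tau_v$ accesses other than its own local variables; leaves have size at most $K$; and a node at level $i$ satisfies $c_1\alpha^i r\le|\tau_v|\le c_2\alpha^i r$, where $r$ is the size of the root; * in the up-pass a node accesses local variables of itself and of its parent only; in global memory it writes only to its own output words, and reads only its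 own output words, those of its children, and words outside the output arrays. The output array stores the output words of the nodes of the tree in in-order, the same number of words (between $1$ and $K$, not necessarily used) for each node. A *BP collection* is a finite family of parallel independent BP computations with these constants whose output arrays are disjoint, and in which every global word that is written by some computation of the family is accessed at most $K$ times in total. Its *total size* is the sum of the sizes of its roots. **Work stealing.** On a fork, the core executing the node continues with the left child and puts the right child on the bottom of its task queue; when it completes the left child it executes the right child if that is still on its queue. A core without work and with empty queue may take an original task of the collection, or steal a task from the top of another core's queue. After a join, the core that completed the child finishing last continues with the parent. Every original or stolen task has an execution stack of its own, allocated in whole blocks, which holds the local variables of those nodes on its current path that are not inside a task stolen from it, in last-in first-out order. The *up-pass* is the period from the time at which the last task of the down-pass starts until all roots are completed. A core is *without work* when it is neither computing nor waiting on a cache miss or block miss. **Priority work stealing (PWS).** The root is started by one core at time $0$. The execution proceeds in rounds with non-decreasing levels $d$; in a round with level $d$ only tasks of level $d$ are stolen, and the round is not in force before all tasks of level less than $d$ have left the task queues and all inner nodes of level less than $d$ have forked. A core without work always takes part in a steal attempt in the current round, which ends when the core starts a stolen task or when the round ends. The steal delay $s_P$ is an upper bound on the duration of every steal attempt made while there are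 tasks that have not started. **Theorem.** Fix $K,\alpha,c_1,c_2$ as above. 1. There is a constant $C>0$, depending only on $K,\alpha,c_1,c_2$, such that for every BP collection of total size $n\ge 2$ and every execution of it under work stealing (in particular under PWS) on $p$ cores with parameters $B,b\ge1$, the total time that the $p$ cores are without work during the up-pass (so also the total idle time during the up-pass) is at most $$C\,b\,p\,(\log n+B\log B).$$ 2. For every $\kappa>0$ there is a constant $C>0$, depending only on $\kappa,K,\alpha,c_1,c_2$, such that for every BP computation of size $n\ge2$ and every execution of it under PWS on $p$ cores with parameters $B,b\ge 1$ and steal delay $s_P\ge\kappa b$, the total time that the $p$ cores are without work in the whole execution (idle time and time spent on steals together) is at most $$C\,s_P\,p\log n+C\,b\,B\,p\log B .$$ Here $\log=\log_2$. -/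

import Mathlib

namespace PWS

/-! ### BP computations -/

/-- A node of a binary tree: the sequence of turns from the root, last turn first
(`false` is left, `true` is right).  The children of `v` are `false :: v` and `true :: v`,
its level is `v.length`, and `u` is an ancestor of `v` (or `v` itself) iff `u <:+ v`.
A node is identified with the task whose computation is the subtree below it. -/
abbrev Path := List Bool

/-- The two phases of a node: its task head in the down-pass (for a leaf: the leaf computation),
and its computation in the up-pass. -/
inductive Phase
  | down
  | up

/-- A variable: the `j`-th local variable declared by node `u`, or the word with address `a` of the
global memory (input and output arrays). -/
inductive Var
  | loc (u : Path) (j : ℕ)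
  | glob (a : ℕ)
  deriving DecidableEq

/-- A single operation of a program. -/
inductive Op
  | compute
  | read (x : Var)
  | write (x : Var)

/-- The variable that an operation accesses, if any. -/
def Op.var : Op → Option Var
  | .compute => none
  | .read x => some x
  | .write x => some x

/-- The raw data of a fork-join computation on a binary tree. -/
structure BP where
  /-- the nodes of the tree -/
  nodes : Finset Path
  /-- the operations that a node performs in each of its two phases -/
  prog : Path → Phase → List Op
  /-- the number of local variables that a node declares -/
  frame : Path → ℕ
  /-- the size of a task (an upper bound on the number of words that it accesses) -/
  size : Path → ℕ
  /-- the address of the output array of the up-tree -/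
  outBase : ℕ
  /-- the number of output words reserved for each node of the up-tree -/
  outWidth : ℕ

namespace BP

variable (P : BP)

/-- `v` is a leaf of the tree. -/
def IsLeaf (v : Path) : Prop := v ∈ P.nodes ∧ false :: v ∉ P.nodes

/-- All operations of a node. -/
def ops (v : Path) : List Op := P.prog v .down ++ P.prog v .up

/-- The number of accesses to the variable `x` in the whole computation. -/
def accesses (x : Var) : ℕ :=
  ∑ v ∈ P.nodes, (P.ops v).countP (fun o => decide (o.var = some x))

/-- The variable `x` is written by the computation. -/
def Writes (x : Var) : Prop := ∃ v ∈ P.nodes, Op.write x ∈ P.ops v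

/-- The data accessed by the task `v`: the variables accessed in the subtree of `v` that are not
local variables declared in this subtree. -/
def data (v : Path) : Set Var :=
  {x | (∃ u ∈ P.nodes, v <:+ u ∧ ∃ o ∈ P.ops u, o.var = some x) ∧
    ∀ u j, x = .loc u j → ¬ v <:+ u}

/-- The number of nodes in the subtree of `v`. -/
def subtreeCard (v : Path) : ℕ := (P.nodes.filter (fun u => v <:+ u)).card

/-- The number of nodes that precede the whole subtree of `v` in the in-order traversal. -/
def inorderStart : Path → ℕ
  | [] => 0
  | false :: v => inorderStart v
  | true :: v => inorderStart v + P.subtreeCard (false :: v) + 1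

/-- The rank of `v` in the in-order traversal of the tree. -/
def inorderIndex (v : Path) : ℕ := P.inorderStart v + P.subtreeCard (false :: v)

/-- The addresses of the output words of node `v`: the output array stores the output data of the
nodes of the up-tree in in-order. -/
def outWords (v : Path) : Set ℕ :=
  Set.Ico (P.outBase + P.outWidth * P.inorderIndex v)
    (P.outBase + P.outWidth * (P.inorderIndex v + 1))

/-- The addresses of the output array of the up-tree. -/
def outArray : Set ℕ := Set.Ico P.outBase (P.outBase + P.outWidth * P.nodes.card)

/-- `P` is a (limited-access) balanced parallel computation; `K` is the common bound for the
quantities that are `O(1)`, and `α`, `c₁`, `c₂` are the constants of the balance condition. -/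
structure IsBP (K : ℕ) (α c₁ c₂ : ℝ) : Prop where
  root_mem : [] ∈ P.nodes
  /-- the nodes form a binary tree in which every node has two children or none -/
  parent_mem : ∀ c v, c :: v ∈ P.nodes → v ∈ P.nodes
  sibling_mem : ∀ c v, c :: v ∈ P.nodes → (!c) :: v ∈ P.nodes
  /-- every node performs `O(1)` operations in each phase (and at least one, the fork or join) -/
  prog_nonempty : ∀ v ∈ P.nodes, ∀ ph, P.prog v ph ≠ []
  prog_length : ∀ v ∈ P.nodes, ∀ ph, (P.prog v ph).length ≤ K
  /-- every node declares `O(1)` local variables -/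
  frame_le : ∀ v ∈ P.nodes, P.frame v ≤ K
  /-- in the down-pass a node may access its own local variables, those of its ancestors,
  and global words -/
  down_scope : ∀ v ∈ P.nodes, ∀ o ∈ P.prog v .down, ∀ u j, o.var = some (.loc u j) →
    u <:+ v ∧ j < P.frame u
  /-- in the up-pass a node accesses, on the execution stacks, the local variables declared by
  itself and by its parent -/
  up_scope : ∀ v ∈ P.nodes, ∀ o ∈ P.prog v .up, ∀ u j, o.var = some (.loc u j) →
    (u = v ∨ u = v.tail) ∧ j < P.frame u
  /-- limited access, local variables -/
  limited_loc : ∀ u j, P.Writes (.loc u j) → P.accesses (.loc u j) ≤ K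
  /-- sizes are positive and bound the number of words accessed by the task; the size of a leaf
  is `O(1)` -/
  size_pos : ∀ v ∈ P.nodes, 1 ≤ P.size v
  data_le : ∀ v ∈ P.nodes, (P.data v).encard ≤ P.size v
  leaf_size : ∀ v, P.IsLeaf v → P.size v ≤ K
  /-- the balance condition -/
  balance_lower : ∀ v ∈ P.nodes, c₁ * α ^ v.length * P.size [] ≤ P.size v
  balance_upper : ∀ v ∈ P.nodes, (P.size v : ℝ) ≤ c₂ * α ^ v.length * P.size []
  /-- every node of the up-tree has `O(1)` output words (which it need not use) -/
  outWidth_pos : 1 ≤ P.outWidth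
  outWidth_le : P.outWidth ≤ K

end BP

/-- A limited-access BP collection: finitely many parallel independent BP computations.
Writable global words are accessed `O(1)` times in total, the output arrays are disjoint, and in the
up-pass a node accesses global memory only to read or write its own output words, to read those of
its children, and to read words outside of the output arrays. -/
structure IsBPCollection {k : ℕ} (P : Fin k → BP) (K : ℕ) (α c₁ c₂ : ℝ) : Prop where
  isBP : ∀ i, (P i).IsBP K α c₁ c₂
  limited_glob : ∀ a, (∃ i, (P i).Writes (.glob a)) → ∑ i, (P i).accesses (.glob a) ≤ K
  disjoint_out : ∀ i i', i ≠ i' → Disjoint (P i).outArray (P i').outArray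
  up_write : ∀ i, ∀ v ∈ (P i).nodes, ∀ a, Op.write (.glob a) ∈ (P i).prog v .up →
    a ∈ (P i).outWords v
  up_read : ∀ i, ∀ v ∈ (P i).nodes, ∀ a, Op.read (.glob a) ∈ (P i).prog v .up →
    a ∈ (P i).outWords v ∨ (∃ c, c :: v ∈ (P i).nodes ∧ a ∈ (P i).outWords (c :: v)) ∨
      ∀ i', a ∉ (P i').outArray

/-- The total size of a BP collection. -/
def totalSize {k : ℕ} (P : Fin k → BP) : ℕ := ∑ i, (P i).size []

/-! ### Executions on a multicore under work stealing -/

/-- A memory block: a block of the global memory, or the `q`-th block of the execution stack that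
was created for the task `τ` of the `i`-th computation. -/
inductive Block (k : ℕ)
  | glob (q : ℕ)
  | stack (i : Fin k) (τ : Path) (q : ℕ)

/-- The raw data of an execution of `k` tree computations on `p` cores, in discrete time. -/
structure Execution (k p : ℕ) where
  /-- the tasks that were stolen -/
  stolen : Fin k → Path → Bool
  /-- the core that executes a phase of a node -/
  core : Fin k → Path → Phase → Fin p
  /-- `time i v ph j` is the time at which the first `j` operations of the phase are completed; the
  `j`-th operation (counted from zero) is in progress in `[time i v ph j, time i v ph (j + 1))` -/
  time : Fin k → Path → Phase → ℕ → ℕ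

namespace Execution

variable {k p : ℕ} (X : Execution k p) (P : Fin k → BP)

/-- The time at which a phase of a node starts. -/
def start (i : Fin k) (v : Path) (ph : Phase) : ℕ := X.time i v ph 0

/-- The time at which a phase of a node is completed. -/
def finish (i : Fin k) (v : Path) (ph : Phase) : ℕ := X.time i v ph ((P i).prog v ph).length

/-- The task (original or stolen) whose kernel contains `v`; the local variables of `v` are on the
execution stack of this task. -/
def kernelRoot (i : Fin k) : Path → Path
  | [] => []
  | c :: v => if X.stolen i (c :: v) then c :: v else kernelRoot i v

/-- The position of the local variables of `v` on the execution stack: they lie directly above those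
of its ancestors in the same kernel. -/
def stackOffset (i : Fin k) : Path → ℕ
  | [] => 0
  | c :: v => if X.stolen i (c :: v) then 0 else stackOffset i v + (P i).frame v

/-- The block that contains a variable of the `i`-th computation; blocks have `B` words, and each
execution stack is allocated in whole blocks of its own. -/
def block (B : ℕ) (i : Fin k) : Var → Block k
  | .glob a => .glob (a / B)
  | .loc u j => .stack i (X.kernelRoot i u) ((X.stackOffset P i u + j) / B)

/-- At time `t` core `c` is executing the given phase of node `v` of the `i`-th computation
(that is, it is computing or waiting on a cache miss or block miss there). -/
def Executes (c : Fin p) (t : ℕ) (i : Fin k) (v : Path) (ph : Phase) : Prop :=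
  v ∈ (P i).nodes ∧ X.core i v ph = c ∧ X.start i v ph ≤ t ∧ t < X.finish P i v ph

/-- At time `t` core `c` is computing or waiting on a cache miss or block miss. -/
def Working (c : Fin p) (t : ℕ) : Prop := ∃ i v ph, X.Executes P c t i v ph

/-- `X` is an execution of `P` under work stealing, with blocks of `B` words, where a cache miss
takes at most `b` time units. -/
structure IsWorkStealing (B b : ℕ) : Prop where
  /-- operations of a phase are executed one after the other; a step without memory access takes
  one time unit -/
  time_lt : ∀ i, ∀ v ∈ (P i).nodes, ∀ ph, ∀ j < ((P i).prog v ph).length,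
    X.time i v ph j < X.time i v ph (j + 1)
  time_compute : ∀ i, ∀ v ∈ (P i).nodes, ∀ ph j, ((P i).prog v ph)[j]? = some .compute →
    X.time i v ph (j + 1) = X.time i v ph j + 1
  /-- a core executes at most one thing at a time -/
  exclusive : ∀ c t i v ph i' v' ph', X.Executes P c t i v ph → X.Executes P c t i' v' ph' →
    i = i' ∧ v = v' ∧ ph = ph'
  /-- roots are original tasks -/
  root_not_stolen : ∀ i, X.stolen i [] = false
  /-- after the fork, the same core continues with the left child; the right child goes to the
  bottom of its task queue -/
  left : ∀ i v, false :: v ∈ (P i).nodes →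
    X.stolen i (false :: v) = false ∧
    X.core i (false :: v) .down = X.core i v .down ∧
    X.start i (false :: v) .down = X.finish P i v .down
  /-- a right child that is still on the queue when its core completes the left child is then
  executed by this core -/
  right_kept : ∀ i v, true :: v ∈ (P i).nodes → X.stolen i (true :: v) = false →
    X.core i (false :: v) .up = X.core i v .down ∧
    X.core i (true :: v) .down = X.core i v .down ∧
    X.start i (true :: v) .down = X.finish P i (false :: v) .up
  /-- otherwise it was stolen by another core while it was on the queue -/
  right_stolen : ∀ i v, true :: v ∈ (P i).nodes → X.stolen i (true :: v) = true →
    X.core i (true :: v) .down ≠ X.core i v .down ∧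
    X.finish P i v .down ≤ X.start i (true :: v) .down ∧
    X.start i (true :: v) .down ≤ X.finish P i (false :: v) .up
  /-- tasks are stolen from the top of a queue: when `s` is stolen, the right children that the same
  kernel has forked on the way to `s` and not yet started have been stolen before -/
  steal_top : ∀ i v s, s ∈ (P i).nodes → X.stolen i s = true → false :: v <:+ s →
    X.kernelRoot i s.tail = X.kernelRoot i v →
    X.stolen i (true :: v) = true ∧ X.start i (true :: v) .down ≤ X.start i s .down
  /-- a core obtains an original or stolen task only when its own task queue is empty -/
  queue_empty : ∀ i, ∀ s ∈ (P i).nodes, (s = [] ∨ X.stolen i s = true) →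
    ∀ i' v, true :: v ∈ (P i').nodes → X.core i' v .down = X.core i s .down →
      X.finish P i' v .down ≤ X.start i s .down →
      X.start i' (true :: v) .down ≤ X.start i s .down
  /-- a leaf continues directly with its up-pass computation -/
  leaf_up : ∀ i v, (P i).IsLeaf v →
    X.core i v .up = X.core i v .down ∧ X.start i v .up = X.finish P i v .down
  /-- the up-pass computation at an inner node starts as soon as both children are completed, on the
  core that completed the child finishing last -/
  join_start : ∀ i v, false :: v ∈ (P i).nodes →
    X.start i v .up = max (X.finish P i (false :: v) .up) (X.finish P i (true :: v) .up)
  join_core : ∀ i v, false :: v ∈ (P i).nodes →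
    ∃ c, X.core i v .up = X.core i (c :: v) .up ∧
      X.finish P i ((!c) :: v) .up ≤ X.finish P i (c :: v) .up
  /-- cache misses and block misses: an access is not delayed during `b` consecutive time units
  unless another core completes a write into the same block in the meantime; the order in which
  cores are given access to a block is arbitrary -/
  delay : ∀ i, ∀ v ∈ (P i).nodes, ∀ ph j o x, ((P i).prog v ph)[j]? = some o → o.var = some x →
    ∀ t, X.time i v ph j ≤ t → t + b < X.time i v ph (j + 1) →
      ∃ i' v' ph' j' y, v' ∈ (P i').nodes ∧ ((P i').prog v' ph')[j']? = some (.write y) ∧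
        X.block P B i' y = X.block P B i x ∧ X.core i' v' ph' ≠ X.core i v ph ∧
        t < X.time i' v' ph' (j' + 1) ∧ X.time i' v' ph' (j' + 1) ≤ t + b

/-- The time at which the last task of the down-pass starts its computation. -/
def upPassStart : ℕ := Finset.univ.sup fun i => (P i).nodes.sup fun v => X.start i v .down

/-- The time at which the whole computation is completed. -/
def completion : ℕ := Finset.univ.sup fun i => (P i).nodes.sup fun v => X.finish P i v .up

/-- The number of cores that are without work at time `t`. -/
noncomputable def idleCores (t : ℕ) : ℕ := {c : Fin p | ¬ X.Working P c t}.ncard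

/-- The total idle time of all cores during the up-pass, that is, from the time at which the last
task of the down-pass starts until the completion of all roots. -/
noncomputable def upPassIdleTime : ℕ :=
  ∑ t ∈ Finset.Ico (X.upPassStart P) (X.completion P), X.idleCores P t

/-- The total time that all cores spend neither computing nor waiting on a cache miss or block miss
in the whole execution.  Time spent on steals is included, so this is at least the idle time. -/
noncomputable def idleTime : ℕ := ∑ t ∈ Finset.range (X.completion P), X.idleCores P t

end Execution

/-- The execution `X` of the single BP computation `P` follows priority work stealing.  The priority
of a task decreases with its level, and `round t` is the level of the tasks that can be stolen
at time `t`.  A core without work always takes part in the current round; such a steal attempt ends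
when the core starts a stolen task (success) or when the round ends (failure; a new attempt is then
made in the next round), and it takes at most `sP` time units. -/
structure IsPWS {p : ℕ} (X : Execution 1 p) (P : BP) (round : ℕ → ℕ) (sP : ℕ) : Prop where
  /-- initially the root task is given to one core -/
  root_start : X.start 0 [] .down = 0
  /-- rounds proceed by non-increasing priority -/
  round_mono : Monotone round
  /-- in a round only tasks of its priority are stolen -/
  steal_round : ∀ s ∈ P.nodes, X.stolen 0 s = true → round (X.start 0 s .down) = s.length
  /-- a round does not start before all tasks of higher priority have left the task queues, -/
  round_queues : ∀ t, ∀ v ∈ P.nodes, v.length < round t → X.start 0 v .down ≤ t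
  /-- and before the cores executing task heads of higher priority have generated their task -/
  round_forks : ∀ t v, false :: v ∈ P.nodes → v.length < round t →
    X.finish (fun _ => P) 0 v .down ≤ t
  /-- as long as there are tasks that have not started, a steal attempt takes at most `sP` -/
  steal_delay : ∀ c t,
    (∀ t', t ≤ t' → t' ≤ t + sP → ¬ X.Working (fun _ => P) c t' ∧ round t' = round t) →
    X.upPassStart (fun _ => P) ≤ t + sP

end PWS

/-! At most `p` cores are idle at any time, so part 1 reduces to showing that the up-pass lasts `O(b
(log n + B log B))`. In the up-pass all tasks have started, so the uncompleted nodes of a kernel lie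
on one path. Each stack address is then used for writes to a single variable, and limited access
leaves at most `K * B` writes into any block (`card_writes_le`). Every `b` units of delay require
such a write, so an operation takes time `O(B b)` (`time_succ_le`).

This crude bound is affordable only on `O(log B)` levels. By balance, all leaves lie within a
constant number of levels of the bottom, so at height `log B + O(1)` both subtrees of a node have at
least `B` nodes. The in-order layout then keeps a block around an output word of such a node inside
the words of its subtree, and comparable nodes are never in the up-pass at the same time: global
block misses disappear (`not_interfere_glob`). On stacks, a node touches only its own and its
parent's variables, which leaves few possible writers (`interfere`). `time_le_potential` follows the
causes of delay backwards in steps of at most `b`: each step either uses up an operation near the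
current root path or moves to a deeper node. Amortization gives `O(log n)` steps.

For part 2 it remains to count steal attempts in the down-pass, each lasting at most `sP`. An
attempt ends with its round, with the down-pass, or with a success. The rounds have at most `depth +
1` levels. A core loses at most one task of each level, because tasks that are on its queue together
have different levels (`eq_of_queued`). So there are `O(p log n)` attempts. -/

namespace PWS

/-! ### Suffixes -/

theorem suffix_or_diverge (u v : Path) :
    u <:+ v ∨ v <:+ u ∨ ∃ c w, c :: w <:+ u ∧ (!c) :: w <:+ v := by
  induction u with
  | nil => exact .inl List.nil_suffix
  | cons a u ih =>
    rcases ih with ⟨l, rfl⟩ | h | ⟨c, w, h1, h2⟩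
    · rcases List.eq_nil_or_concat l with rfl | ⟨l, d, rfl⟩
      · exact .inr (.inl (by simp))
      · by_cases hd : d = a
        · exact .inl ⟨l, by simp [hd]⟩
        · refine .inr (.inr ⟨a, u, List.suffix_rfl, l, ?_⟩)
          have : d = !a := by cases a <;> cases d <;> simp_all
          simp [this]
    · exact .inr (.inl (h.trans (List.suffix_cons a u)))
    · exact .inr (.inr ⟨c, w, h1.trans (List.suffix_cons a u), h2⟩)

theorem not_cons_suffix_self {c : Bool} {v : Path} : ¬ c :: v <:+ v := fun h => by
  have := h.length_le
  simp at this

theorem eq_of_cons_suffix {c d : Bool} {w v : Path} (h1 : c :: w <:+ v) (h2 : d :: w <:+ v) :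
    c = d := by
  have := List.suffix_of_suffix_length_le h1 h2 (by simp)
  have := this.eq_of_length (by simp)
  simpa using this

theorem suffix_iff_eq_or_cons_suffix {u v : Path} :
    u <:+ v ↔ v = u ∨ ∃ c, c :: u <:+ v := by
  constructor
  · rintro ⟨l, rfl⟩
    rcases List.eq_nil_or_concat l with rfl | ⟨l, d, rfl⟩
    · exact .inl (by simp)
    · exact .inr ⟨d, l, by simp⟩
  · rintro (rfl | ⟨c, h⟩)
    · exact List.suffix_rfl
    · exact (List.suffix_cons c u).trans h

/-! ### Trees -/

namespace BP

variable {P : BP} {K : ℕ} {α c₁ c₂ : ℝ}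

/-- The largest level of a node. -/
def depth (P : BP) : ℕ := P.nodes.sup List.length

theorem length_le_depth {v : Path} (hv : v ∈ P.nodes) : v.length ≤ P.depth :=
  Finset.le_sup (f := List.length) hv

theorem induction_up {motive : Path → Prop}
    (h : ∀ v ∈ P.nodes, (∀ c, c :: v ∈ P.nodes → motive (c :: v)) → motive v) :
    ∀ v ∈ P.nodes, motive v := by
  suffices ∀ m, ∀ v ∈ P.nodes, P.depth ≤ v.length + m → motive v from
    fun v hv => this P.depth v hv (by omega)
  intro m
  induction m with
  | zero =>
    intro v hv hl
    refine h v hv fun c hc => ?_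
    have := length_le_depth hc
    simp at this
    omega
  | succ m ih =>
    intro v hv hl
    refine h v hv fun c hc => ih _ hc ?_
    simp
    omega

namespace IsBP

variable (hP : P.IsBP K α c₁ c₂)
include hP

theorem mem_of_suffix {u v : Path} (h : u <:+ v) (hv : v ∈ P.nodes) : u ∈ P.nodes := by
  obtain ⟨l, rfl⟩ := h
  induction l with
  | nil => exact hv
  | cons a l ih => exact ih (hP.parent_mem _ _ hv)

theorem child_mem {c : Bool} (d : Bool) {v : Path} (h : c :: v ∈ P.nodes) : d :: v ∈ P.nodes := by
  by_cases hd : d = c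
  · exact hd ▸ h
  · have : d = !c := by cases c <;> cases d <;> simp_all
    exact this ▸ hP.sibling_mem _ _ h

/-! ### Consequences of the balance condition -/

theorem exists_depth : ∃ v ∈ P.nodes, v.length = P.depth := by
  obtain ⟨v, hv, h⟩ := Finset.exists_mem_eq_sup P.nodes ⟨_, hP.root_mem⟩ List.length
  exact ⟨v, hv, h.symm⟩

/-- A deepest node still has size at least 1; apply the upper balance bound to it. -/
theorem inv_pow_depth_le (hα₀ : 0 < α) : (1 / α) ^ P.depth ≤ c₂ * P.size [] := by
  obtain ⟨v, hv, h⟩ := hP.exists_depth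
  have h1 := hP.balance_upper v hv
  have h2 : (1 : ℝ) ≤ P.size v := by exact_mod_cast hP.size_pos v hv
  rw [h] at h1
  have h3 : 0 < α ^ P.depth := by positivity
  rw [one_div, inv_pow, inv_le_iff_one_le_mul₀ h3]
  calc (1 : ℝ) ≤ _ := h2.trans h1
    _ = _ := by ring

/-- A leaf has size at most `K`, so the lower balance bound makes `α ^ v.length * r` at most `K /
c₁`, where `r` is the root size. Together with `inv_pow_depth_le`, levels below the leaf's can
number only a constant. -/
theorem depth_lt_of_isLeaf (hα₀ : 0 < α) (hα₁ : α < 1) (hc₁ : 0 < c₁) (hc₂ : 1 ≤ c₂) {D : ℕ}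
    (hD : K * c₂ / c₁ < (1 / α) ^ D) {v : Path} (hv : P.IsLeaf v) : P.depth < v.length + D := by
  by_contra! hlt
  obtain ⟨m, hm⟩ := Nat.exists_eq_add_of_le hlt
  have h1 := hP.inv_pow_depth_le hα₀
  have h2 := hP.balance_lower v hv.1
  have h3 : (P.size v : ℝ) ≤ K := by exact_mod_cast hP.leaf_size v hv
  have h4 : 1 ≤ 1 / α := by rw [le_div_iff₀ hα₀]; linarith
  have h5 : (1 / α) ^ (v.length + D) ≤ c₂ * P.size [] :=
    (pow_le_pow_right₀ h4 hlt).trans h1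
  have h6 : 0 < α ^ v.length := by positivity
  have h7 : (1 / α) ^ D ≤ c₂ * (α ^ v.length * P.size []) := by
    rw [pow_add, one_div_pow, one_div, inv_mul_le_iff₀ h6] at h5
    linarith
  have h8 : α ^ v.length * P.size [] ≤ K / c₁ := by
    rw [le_div_iff₀ hc₁]
    linarith
  have h9 : (1 / α) ^ D ≤ c₂ * (K / c₁) := h7.trans (by gcongr)
  have : K * c₂ / c₁ = c₂ * (K / c₁) := by ring
  linarith

/-! ### Subtree cardinalities and the in-order layout of the output array -/

omit hP in
theorem subtreeCard_eq {v : Path} (hv : v ∈ P.nodes) :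
    P.subtreeCard v = P.subtreeCard (false :: v) + 1 + P.subtreeCard (true :: v) := by
  have : P.nodes.filter (fun u => v <:+ u) =
      insert v (P.nodes.filter (fun u => false :: v <:+ u) ∪
        P.nodes.filter (fun u => true :: v <:+ u)) := by
    ext u
    simp only [Finset.mem_filter, Finset.mem_insert, Finset.mem_union]
    rw [suffix_iff_eq_or_cons_suffix]
    simp only [Bool.exists_bool]
    constructor
    · tauto
    · rintro (rfl | h) <;> tauto
  rw [subtreeCard, this, Finset.card_insert_of_notMem, Finset.card_union_of_disjoint]
  · simp only [subtreeCard]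
    omega
  · rw [Finset.disjoint_left]
    intro u h1 h2
    simp only [Finset.mem_filter] at h1 h2
    simpa using eq_of_cons_suffix h1.2 h2.2
  · simp [not_cons_suffix_self]

/-- No node at least `D` levels above the bottom is a leaf, so the tree below `v` branches fully for
`h` levels. -/
theorem two_pow_le_subtreeCard {D : ℕ} (hD : ∀ v, P.IsLeaf v → P.depth < v.length + D)
    (h : ℕ) {v : Path} (hv : v ∈ P.nodes) (hh : v.length + D + h ≤ P.depth) :
    2 ^ h ≤ P.subtreeCard v := by
  induction h generalizing v with
  | zero => rw [subtreeCard_eq hv]; simp; omega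
  | succ h ih =>
    have hl : false :: v ∈ P.nodes := by
      by_contra hn
      have := hD v ⟨hv, hn⟩
      omega
    have h1 := ih hl (by simp; omega)
    have h2 := ih (hP.child_mem true hl) (by simp; omega)
    rw [subtreeCard_eq hv, pow_succ]
    omega

/-- The subtrees of comparable nodes occupy nested in-order intervals. -/
theorem inorder_nested {u v : Path} (h : u <:+ v) (hv : v ∈ P.nodes) :
    P.inorderStart u ≤ P.inorderStart v ∧
      P.inorderStart v + P.subtreeCard v ≤ P.inorderStart u + P.subtreeCard u := by
  obtain ⟨l, rfl⟩ := h
  induction l with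
  | nil => simp
  | cons a l ih =>
    have hm : l ++ u ∈ P.nodes := hP.parent_mem _ _ hv
    obtain ⟨h1, h2⟩ := ih hm
    have := subtreeCard_eq hm
    rw [List.cons_append]
    cases a <;> simp only [inorderStart] <;> omega

/-- If `z` is not an ancestor of `v`, its in-order interval lies wholly on one side of `v`: inside
one subtree of `v`, or in the other branch where the two paths part. -/
theorem suffix_of_inorderIndex {z v : Path} (hz : z ∈ P.nodes) (hv : v ∈ P.nodes)
    (h1 : P.inorderStart z ≤ P.inorderIndex v)
    (h2 : P.inorderIndex v < P.inorderStart z + P.subtreeCard z) : z <:+ v := by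
  rcases suffix_or_diverge z v with h | h | ⟨c, w, hz', hv'⟩
  · exact h
  · rcases suffix_iff_eq_or_cons_suffix.1 h with rfl | ⟨c, h⟩
    · exact List.suffix_rfl
    · have h3 := hP.inorder_nested h hz
      have := subtreeCard_eq hv
      cases c <;> simp only [inorderIndex, inorderStart] at * <;> omega
  · have h3 := hP.inorder_nested hz' hz
    have h4 := hP.inorder_nested hv' hv
    have := subtreeCard_eq hv
    cases c <;> simp only [inorderIndex, inorderStart, Bool.not_false, Bool.not_true] at * <;> omega

omit hP in
theorem card_nodes : P.subtreeCard [] = P.nodes.card := by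
  simp [subtreeCard]

/-- If both subtrees of `z` have at least `B` nodes, every word at distance less than `B` from an
output word of `z` is an output word reserved for the subtree of `z`. -/
theorem near_outWords {B a a' : ℕ} {z : Path} (hz : z ∈ P.nodes)
    (hB : ∀ c, B ≤ P.subtreeCard (c :: z)) (ha : a ∈ P.outWords z) (h1 : a < a' + B)
    (h2 : a' < a + B) :
    P.outBase + P.outWidth * P.inorderStart z ≤ a' ∧
      a' < P.outBase + P.outWidth * (P.inorderStart z + P.subtreeCard z) := by
  have hW := hP.outWidth_pos
  have hl := hB false
  have hr := hB true
  have hc := subtreeCard_eq hz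
  obtain ⟨h3, h4⟩ := ha
  rw [inorderIndex] at h3 h4
  have e1 : P.outWidth * (P.inorderStart z + P.subtreeCard (false :: z)) =
    P.outWidth * P.inorderStart z + P.outWidth * P.subtreeCard (false :: z) := by ring
  have e2 : P.outWidth * (P.inorderStart z + P.subtreeCard z) =
    P.outWidth * (P.inorderStart z + P.subtreeCard (false :: z) + 1) +
      P.outWidth * P.subtreeCard (true :: z) := by rw [hc]; ring
  -- Each node reserves at least one word, so each subtree provides a margin of at least `B` words
  -- on its side of the words of `z`.
  have h5 := Nat.mul_le_mul hW hl
  have h6 := Nat.mul_le_mul hW hr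
  omega

theorem outWords_subset_outArray {z : Path} (hz : z ∈ P.nodes) {a : ℕ}
    (h1 : P.outBase + P.outWidth * P.inorderStart z ≤ a)
    (h2 : a < P.outBase + P.outWidth * (P.inorderStart z + P.subtreeCard z)) :
    a ∈ P.outArray := by
  have h := (hP.inorder_nested (u := []) List.nil_suffix hz).2
  rw [card_nodes, inorderStart, zero_add] at h
  have := Nat.mul_le_mul_left P.outWidth h
  constructor <;> omega

theorem mem_outArray {z : Path} (hz : z ∈ P.nodes) {a : ℕ} (ha : a ∈ P.outWords z) :
    a ∈ P.outArray := by
  have hc := subtreeCard_eq hz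
  obtain ⟨h3, h4⟩ := ha
  refine hP.outWords_subset_outArray hz (le_trans ?_ h3) (lt_of_lt_of_le h4 ?_)
  · gcongr; simp [inorderIndex]
  · refine Nat.add_le_add_left (Nat.mul_le_mul_left _ ?_) _
    simp only [inorderIndex]
    omega

theorem suffix_of_mem_outWords {z v : Path} (hz : z ∈ P.nodes) (hv : v ∈ P.nodes) {a : ℕ}
    (ha : a ∈ P.outWords v) (h1 : P.outBase + P.outWidth * P.inorderStart z ≤ a)
    (h2 : a < P.outBase + P.outWidth * (P.inorderStart z + P.subtreeCard z)) : z <:+ v := by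
  obtain ⟨h3, h4⟩ := ha
  refine hP.suffix_of_inorderIndex hz hv ?_ ?_
  · have : P.outWidth * P.inorderStart z < P.outWidth * (P.inorderIndex v + 1) := by omega
    have := lt_of_mul_lt_mul_left this (Nat.zero_le _)
    omega
  · have : P.outWidth * P.inorderIndex v < P.outWidth * (P.inorderStart z + P.subtreeCard z) := by
      omega
    exact lt_of_mul_lt_mul_left this (Nat.zero_le _)

end IsBP

/-! ### Counting accesses -/

theorem card_le_countP (l : List Op) (x : Var) (S : Finset ℕ)
    (h : ∀ j ∈ S, ∃ o, l[j]? = some o ∧ o.var = some x) :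
    S.card ≤ l.countP (fun o => decide (o.var = some x)) := by
  induction l generalizing S with
  | nil =>
    have : S = ∅ := Finset.eq_empty_of_forall_notMem fun j hj => by simpa using h j hj
    simp [this]
  | cons a l ih =>
    have h1 : ((S.erase 0).image Nat.pred).card = (S.erase 0).card := by
      refine Finset.card_image_of_injOn fun i hi j hj hij => ?_
      simp only [Finset.coe_erase, Set.mem_sdiff, Set.mem_singleton_iff] at hi hj
      simp only [Nat.pred_eq_sub_one] at hij
      omega
    have h2 := ih ((S.erase 0).image Nat.pred) fun j hj => by
      obtain ⟨i, hi, rfl⟩ := Finset.mem_image.1 hj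
      obtain ⟨hi0, hi⟩ := Finset.mem_erase.1 hi
      obtain ⟨i, rfl⟩ := Nat.exists_eq_succ_of_ne_zero hi0
      simpa using h _ hi
    rw [List.countP_cons]
    by_cases h0 : 0 ∈ S
    · have h3 : a.var = some x := by simpa using h 0 h0
      have := Finset.card_erase_add_one h0
      simp only [h3, decide_true, if_true]
      omega
    · rw [Finset.erase_eq_of_notMem h0] at h1 h2
      omega

/-- Events are triples (node, phase, position), so repeated accesses within one program count
separately, as they do in `accesses`. -/
theorem card_le_accesses (P : BP) (x : Var) (S : Finset (Path × Phase × ℕ))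
    (h : ∀ e ∈ S, e.1 ∈ P.nodes ∧ ∃ o, (P.prog e.1 e.2.1)[e.2.2]? = some o ∧ o.var = some x) :
    S.card ≤ P.accesses x := by
  classical
  rw [Finset.card_eq_sum_card_fiberwise (f := Prod.fst) (t := P.nodes) fun e he => (h e he).1,
    accesses]
  refine Finset.sum_le_sum fun v hv => ?_
  have key : ∀ ph, ((S.filter fun e => e.1 = v).filter fun e => e.2.1 = ph).card ≤
      (P.prog v ph).countP (fun o => decide (o.var = some x)) := by
    intro ph
    rw [← Finset.card_image_of_injOn (f := fun e => e.2.2)]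
    · refine card_le_countP _ _ _ fun j hj => ?_
      obtain ⟨e, he, rfl⟩ := Finset.mem_image.1 hj
      simp only [Finset.mem_filter] at he
      obtain ⟨⟨he, rfl⟩, rfl⟩ := he
      exact (h e he).2
    · rintro ⟨a, b, c⟩ he ⟨a', b', c'⟩ he' hee
      simp only [Finset.coe_filter, Finset.mem_filter, Set.mem_ofPred_eq] at he he' hee
      rw [he.1.2, he.2, he'.1.2, he'.2, hee]
  rw [ops, List.countP_append]
  refine le_trans ?_ (add_le_add (key .down) (key .up))
  refine le_trans (Finset.card_le_card ?_) (Finset.card_union_le _ _)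
  rintro ⟨a, b, c⟩ he
  rw [Finset.mem_union, Finset.mem_filter, Finset.mem_filter]
  rw [Finset.mem_filter] at he
  obtain ⟨he, rfl⟩ : _ ∧ a = v := he
  cases b <;> simp [he]

end BP

end PWS

namespace PWS

namespace Execution

variable {k p K B b : ℕ} {α c₁ c₂ : ℝ} {X : Execution k p} {P : Fin k → BP}

/-! ### Kernels -/

theorem kernelRoot_suffix (X : Execution k p) (i : Fin k) (v : Path) : X.kernelRoot i v <:+ v := by
  induction v with
  | nil => exact List.suffix_rfl
  | cons c v ih =>
    rw [kernelRoot]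
    split
    · exact List.suffix_rfl
    · exact ih.trans (List.suffix_cons c v)

/-- The kernel root is the deepest stolen node on the path to `v`, or the tree root if there is
none. -/
theorem stolen_eq_false {i : Fin k} {a v : Path} {c : Bool} (h1 : X.kernelRoot i v <:+ a)
    (h2 : c :: a <:+ v) : X.stolen i (c :: a) = false := by
  induction v with
  | nil => simp at h2
  | cons d v ih =>
    rw [kernelRoot] at h1
    split at h1
    · exact absurd (h2.trans h1) not_cons_suffix_self
    · rename_i h
      rcases List.suffix_cons_iff.1 h2 with h2 | h2
      · rw [h2]; simpa using h
      · exact ih h1 h2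

theorem kernelRoot_eq_of_between {i : Fin k} {a v : Path} (h1 : X.kernelRoot i v <:+ a)
    (h2 : a <:+ v) : X.kernelRoot i v = X.kernelRoot i a := by
  induction v with
  | nil => rw [List.suffix_nil.1 h2]
  | cons d v ih =>
    rcases List.suffix_cons_iff.1 h2 with h2 | h2
    · rw [h2]
    · have h3 := stolen_eq_false (h1.trans h2) List.suffix_rfl
      rw [kernelRoot, h3] at h1 ⊢
      exact ih h1 h2

/-- The common kernel root is an ancestor of both nodes, so it cannot lie beyond their branching
point. -/
theorem kernelRoot_suffix_of_diverge {i : Fin k} {u v w : Path} {c : Bool}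
    (hk : X.kernelRoot i u = X.kernelRoot i v) (hu : c :: w <:+ u) (hv : (!c) :: w <:+ v) :
    X.kernelRoot i u <:+ w := by
  have h1 := X.kernelRoot_suffix i u
  have h2 := X.kernelRoot_suffix i v
  rw [← hk] at h2
  rcases List.suffix_or_suffix_of_suffix h1 hu with h | h
  · rcases List.suffix_cons_iff.1 h with h | h
    · rw [h] at h2
      simpa using eq_of_cons_suffix h2 hv
    · exact h
  · simpa using eq_of_cons_suffix (h.trans h2) hv

/-- Frames along a path of one kernel are disjoint; this identifies a variable by its stack address
in `card_writes_le`. -/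
theorem stackOffset_add_frame_le {i : Fin k} {u v : Path} {c : Bool} (h : c :: u <:+ v)
    (hk : X.kernelRoot i u = X.kernelRoot i v) :
    X.stackOffset P i u + (P i).frame u ≤ X.stackOffset P i v := by
  have hr : X.kernelRoot i v <:+ u := hk ▸ X.kernelRoot_suffix i u
  induction v with
  | nil => simp at h
  | cons d v ih =>
    rcases List.suffix_cons_iff.1 h with h | h
    · have h3 := stolen_eq_false hr (by rw [h])
      injection h with h4 h5
      subst h4 h5
      simp [stackOffset, h3]
    · have h1 : u <:+ v := (List.suffix_cons c u).trans h
      have h3 := stolen_eq_false (hr.trans h1) List.suffix_rfl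
      rw [kernelRoot, h3] at hk hr
      have := ih h (by simpa using hk) (by simpa using hr)
      rw [stackOffset, h3]
      simp only [Bool.false_eq_true, if_false]
      omega

theorem stolen_of_kernelRoot {i : Fin k} (v : Path) :
    X.kernelRoot i v = [] ∨ X.stolen i (X.kernelRoot i v) = true := by
  induction v with
  | nil => exact .inl rfl
  | cons c v ih =>
    rw [kernelRoot]
    split
    · rename_i h; exact .inr h
    · exact ih

/-! ### Order of events -/

section order

variable (hP : IsBPCollection P K α c₁ c₂) (hX : X.IsWorkStealing P B b)
include hX

theorem time_mono {i : Fin k} {v : Path} (hv : v ∈ (P i).nodes) {ph : Phase} {j j' : ℕ}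
    (h : j ≤ j') (h' : j' ≤ ((P i).prog v ph).length) : X.time i v ph j ≤ X.time i v ph j' := by
  induction j', h using Nat.le_induction with
  | base => rfl
  | succ m _ ih => exact (ih (by omega)).trans (hX.time_lt i v hv ph m (by omega)).le

theorem le_finish {i : Fin k} {v : Path} (hv : v ∈ (P i).nodes) {ph : Phase} {j : ℕ}
    (h : j ≤ ((P i).prog v ph).length) : X.time i v ph j ≤ X.finish P i v ph :=
  time_mono hX hv h le_rfl

theorem time_succ_le_finish {i : Fin k} {v : Path} (hv : v ∈ (P i).nodes) {ph : Phase} {j : ℕ}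
    (h : j < ((P i).prog v ph).length) : X.time i v ph (j + 1) ≤ X.finish P i v ph :=
  le_finish hX hv h

theorem start_le {i : Fin k} {v : Path} (hv : v ∈ (P i).nodes) {ph : Phase} {j : ℕ}
    (h : j ≤ ((P i).prog v ph).length) : X.start i v ph ≤ X.time i v ph j :=
  time_mono hX hv (Nat.zero_le j) h

include hP

theorem start_lt_finish {i : Fin k} {v : Path} (hv : v ∈ (P i).nodes) (ph : Phase) :
    X.start i v ph < X.finish P i v ph := by
  have h := List.length_pos_iff.2 ((hP.isBP i).prog_nonempty v hv ph)
  exact (hX.time_lt i v hv ph 0 h).trans_le (le_finish hX hv h)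

theorem finish_child_le {i : Fin k} {v : Path} {c : Bool} (hv : c :: v ∈ (P i).nodes) :
    X.finish P i (c :: v) .up ≤ X.start i v .up := by
  rw [hX.join_start i v ((hP.isBP i).child_mem false hv)]
  cases c
  · exact le_max_left _ _
  · exact le_max_right _ _

theorem finish_down_le_start_up {i : Fin k} :
    ∀ v ∈ (P i).nodes, X.finish P i v .down ≤ X.start i v .up := by
  refine BP.induction_up fun v hv ih => ?_
  by_cases hl : false :: v ∈ (P i).nodes
  · rw [← (hX.left i v hl).2.2]
    exact (start_lt_finish hP hX hl .down).le.trans <| (ih _ hl).trans <|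
      (start_lt_finish hP hX hl .up).le.trans (finish_child_le hP hX hl)
  · exact (hX.leaf_up i v ⟨hv, hl⟩).2.ge

theorem finish_le_finish_up {i : Fin k} {v : Path} (hv : v ∈ (P i).nodes) (ph : Phase) :
    X.finish P i v ph ≤ X.finish P i v .up := by
  cases ph
  · exact (finish_down_le_start_up hP hX v hv).trans (start_lt_finish hP hX hv .up).le
  · rfl

theorem start_down_lt_finish_up {i : Fin k} {v : Path} (hv : v ∈ (P i).nodes) :
    X.start i v .down < X.finish P i v .up :=
  (start_lt_finish hP hX hv .down).trans_le (finish_le_finish_up hP hX hv .down)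

theorem finish_up_mono {i : Fin k} {u v : Path} (h : u <:+ v) (hv : v ∈ (P i).nodes) :
    X.finish P i v .up ≤ X.finish P i u .up := by
  obtain ⟨l, rfl⟩ := h
  induction l with
  | nil => rfl
  | cons a l ih =>
    exact (finish_child_le hP hX hv).trans <|
      (start_lt_finish hP hX ((hP.isBP i).parent_mem _ _ hv) .up).le.trans
        (ih ((hP.isBP i).parent_mem _ _ hv))

theorem finish_up_le_start_up {i : Fin k} {u v : Path} {c : Bool} (h : c :: u <:+ v)
    (hv : v ∈ (P i).nodes) : X.finish P i v .up ≤ X.start i u .up :=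
  (finish_up_mono hP hX h hv).trans (finish_child_le hP hX ((hP.isBP i).mem_of_suffix h hv))

theorem finish_down_le_child {i : Fin k} {v : Path} {c : Bool} (hv : c :: v ∈ (P i).nodes) :
    X.finish P i v .down ≤ X.start i (c :: v) .down := by
  have hl := (hP.isBP i).child_mem false hv
  cases c
  · exact (hX.left i v hl).2.2.ge
  · cases hs : X.stolen i (true :: v)
    · rw [(hX.right_kept i v hv hs).2.2, ← (hX.left i v hl).2.2]
      exact (start_down_lt_finish_up hP hX hl).le
    · exact (hX.right_stolen i v hv hs).2.1

theorem start_down_mono {i : Fin k} {u v : Path} (h : u <:+ v) (hv : v ∈ (P i).nodes) :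
    X.start i u .down ≤ X.start i v .down := by
  obtain ⟨l, rfl⟩ := h
  induction l with
  | nil => rfl
  | cons a l ih =>
    have hm : l ++ u ∈ (P i).nodes := (hP.isBP i).parent_mem _ _ hv
    exact (ih hm).trans <| (start_lt_finish hP hX hm .down).le.trans
      (finish_down_le_child hP hX hv)

omit hP hX in
theorem start_down_le_upPassStart {i : Fin k} {v : Path} (hv : v ∈ (P i).nodes) :
    X.start i v .down ≤ X.upPassStart P :=
  (Finset.le_sup (f := fun v => X.start i v .down) hv).trans
    (Finset.le_sup (f := fun i => (P i).nodes.sup fun v => X.start i v .down) (Finset.mem_univ i))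

/-- If two nodes of a kernel lie in the two subtrees of a node, then the left one is completed
before the right subtree is started. -/
theorem finish_up_le_of_diverge {i : Fin k} {u v w : Path} (hu : u ∈ (P i).nodes)
    (hv : v ∈ (P i).nodes) (hk : X.kernelRoot i u = X.kernelRoot i v) (h1 : false :: w <:+ u)
    (h2 : true :: w <:+ v) : X.finish P i u .up ≤ X.start i (true :: w) .down := by
  -- The kernel root is at or above `w`, so the right child of `w` was not stolen and waits for the
  -- left subtree.
  have h3 := stolen_eq_false (hk ▸ kernelRoot_suffix_of_diverge hk h1 h2) h2
  rw [(hX.right_kept i w ((hP.isBP i).mem_of_suffix h2 hv) h3).2.2]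
  exact finish_up_mono hP hX h1 hu

/-- In the up-pass, the uncompleted nodes of a kernel are on a single path. -/
theorem comparable_of_unfinished {i : Fin k} {u v : Path} (hu : u ∈ (P i).nodes)
    (hv : v ∈ (P i).nodes) (hk : X.kernelRoot i u = X.kernelRoot i v)
    (hu' : X.upPassStart P < X.finish P i u .up) (hv' : X.upPassStart P < X.finish P i v .up) :
    u <:+ v ∨ v <:+ u := by
  rcases suffix_or_diverge u v with h | h | ⟨c, w, h1, h2⟩
  · exact .inl h
  · exact .inr h
  -- At `upPassStart` the right subtree has started, so the node on the left is already completed.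
  · cases c
    · have h3 := finish_up_le_of_diverge hP hX hu hv hk h1 h2
      have h4 := start_down_le_upPassStart (X := X) ((hP.isBP i).mem_of_suffix h2 hv)
      simp only [Bool.not_false] at h4
      omega
    · have h3 := finish_up_le_of_diverge hP hX hv hu hk.symm h2 h1
      have h4 := start_down_le_upPassStart (X := X) ((hP.isBP i).mem_of_suffix h1 hu)
      omega

/-! ### Writes into a block during the up-pass -/

omit hX in
theorem loc_scope {i : Fin k} {v : Path} (hv : v ∈ (P i).nodes) {ph : Phase} {j : ℕ} {o : Op}
    (ho : ((P i).prog v ph)[j]? = some o) {u : Path} {m : ℕ} (hx : o.var = some (.loc u m)) :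
    u <:+ v ∧ m < (P i).frame u := by
  have hmem := List.mem_of_getElem? ho
  cases ph
  · exact (hP.isBP i).down_scope v hv o hmem u m hx
  · obtain ⟨h1, h2⟩ := (hP.isBP i).up_scope v hv o hmem u m hx
    refine ⟨?_, h2⟩
    rcases h1 with rfl | rfl
    · exact List.suffix_rfl
    · exact List.tail_suffix v

/-- The address of a variable within the global memory or within its execution stack. -/
def address (X : Execution k p) (P : Fin k → BP) (i : Fin k) : Var → ℕ
  | .glob a => a
  | .loc u j => X.stackOffset P i u + j

omit hP hX in
theorem writes_of_event {i : Fin k} {v : Path} (hv : v ∈ (P i).nodes) {ph : Phase} {j : ℕ}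
    {y : Var} (ho : ((P i).prog v ph)[j]? = some (.write y)) : (P i).Writes y := by
  refine ⟨v, hv, ?_⟩
  have := List.mem_of_getElem? ho
  cases ph <;> simp [BP.ops, this]

omit hX in
theorem card_glob_le {a : ℕ} (S : Finset (Fin k × Path × Phase × ℕ))
    (hS : ∀ e ∈ S, e.2.1 ∈ (P e.1).nodes ∧
      ((P e.1).prog e.2.1 e.2.2.1)[e.2.2.2]? = some (.write (.glob a))) : S.card ≤ K := by
  classical
  rcases S.eq_empty_or_nonempty with rfl | ⟨e, he⟩
  · simp
  · refine le_trans ?_ (hP.limited_glob a ⟨e.1, writes_of_event (hS e he).1 (hS e he).2⟩)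
    rw [Finset.card_eq_sum_card_fiberwise (f := Prod.fst) (t := Finset.univ) (by simp)]
    refine Finset.sum_le_sum fun i _ => ?_
    rw [← Finset.card_image_of_injOn (f := Prod.snd)]
    · refine BP.card_le_accesses _ _ _ fun f hf => ?_
      obtain ⟨e, he, rfl⟩ := Finset.mem_image.1 hf
      obtain ⟨heS, rfl⟩ := Finset.mem_filter.1 he
      exact ⟨(hS e heS).1, _, (hS e heS).2, rfl⟩
    · rintro ⟨a, e⟩ he ⟨a', e'⟩ he' hee
      simp only [Finset.coe_filter, Set.mem_ofPred_eq] at he he' hee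
      rw [he.2, he'.2, hee]

omit hX in
theorem card_loc_le {i : Fin k} {u : Path} {m : ℕ} (S : Finset (Fin k × Path × Phase × ℕ))
    (hS : ∀ e ∈ S, e.1 = i ∧ e.2.1 ∈ (P i).nodes ∧
      ((P i).prog e.2.1 e.2.2.1)[e.2.2.2]? = some (.write (.loc u m))) : S.card ≤ K := by
  classical
  rcases S.eq_empty_or_nonempty with rfl | ⟨e, he⟩
  · simp
  · refine le_trans ?_ ((hP.isBP i).limited_loc u m
      (writes_of_event (hS e he).2.1 (hS e he).2.2))
    rw [← Finset.card_image_of_injOn (f := Prod.snd)]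
    · refine BP.card_le_accesses _ _ _ fun f hf => ?_
      obtain ⟨e, he, rfl⟩ := Finset.mem_image.1 hf
      exact ⟨(hS e he).2.1, _, (hS e he).2.2, rfl⟩
    · rintro ⟨a, e⟩ he ⟨a', e'⟩ he' hee
      have h1 := (hS _ he).1
      have h2 := (hS _ he').1
      simp only at h1 h2 hee
      rw [h1, h2, hee]

theorem finish_of_event {i : Fin k} {v : Path} (hv : v ∈ (P i).nodes) {ph : Phase} {j : ℕ}
    {o : Op} (ho : ((P i).prog v ph)[j]? = some o) {u : Path} (hu : u <:+ v) :
    X.time i v ph (j + 1) ≤ X.finish P i u .up := by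
  obtain ⟨hj, -⟩ := List.getElem?_eq_some_iff.1 ho
  exact (le_finish hX hv hj).trans <| (finish_le_finish_up hP hX hv ph).trans
    (finish_up_mono hP hX hu hv)

/-- In the up-pass, at most `K * B` writes are completed into any block. -/
theorem card_writes_le (hB : 1 ≤ B) (β : Block k) (S : Finset (Fin k × Path × Phase × ℕ))
    (hS : ∀ e ∈ S, e.2.1 ∈ (P e.1).nodes ∧ ∃ y,
      ((P e.1).prog e.2.1 e.2.2.1)[e.2.2.2]? = some (.write y) ∧ X.block P B e.1 y = β ∧
      X.upPassStart P < X.time e.1 e.2.1 e.2.2.1 (e.2.2.2 + 1)) : S.card ≤ K * B := by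
  classical
  have : Nonempty Var := ⟨.glob 0⟩
  choose! hmem y hy hβ ht using hS
  have hdiv : ∀ q r : ℕ, r / B = q → r ∈ Finset.Ico (q * B) (q * B + B) := by
    rintro q r rfl
    rw [Finset.mem_Ico]
    exact ⟨Nat.div_mul_le_self r B, Nat.lt_div_mul_add hB⟩
  cases β with
  | glob q =>
    rw [show K * B = K * (Finset.Ico (q * B) (q * B + B)).card by simp]
    -- A block has `B` addresses; it suffices to bound the writes to each of them by `K`.
    refine Finset.card_le_mul_card_image_of_maps_to
      (f := fun e => address X P e.1 (y e)) (fun e he => ?_) K fun a _ => ?_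
    · have := hβ e he
      cases hye : y e with
      | loc u j => simp [hye, block] at this
      | glob a =>
        simp only [hye, block, Block.glob.injEq] at this
        simpa [address, hye] using hdiv _ _ this
    · refine card_glob_le hP (a := a) _ fun e he => ?_
      obtain ⟨heS, rfl⟩ := Finset.mem_filter.1 he
      refine ⟨hmem e heS, ?_⟩
      have := hβ e heS
      cases hye : y e with
      | loc u j => simp [hye, block] at this
      | glob a => simpa [address, hye] using hy e heS
  | stack i τ q =>
    rw [show K * B = K * (Finset.Ico (q * B) (q * B + B)).card by simp]
    have key : ∀ e ∈ S, ∃ u m, y e = .loc u m ∧ e.1 = i ∧ X.kernelRoot i u = τ ∧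
        (X.stackOffset P i u + m) / B = q := by
      intro e he
      have := hβ e he
      cases hye : y e with
      | glob a => simp [hye, block] at this
      | loc u m =>
        simp only [hye, block, Block.stack.injEq] at this
        obtain ⟨rfl, h1, h2⟩ := this
        exact ⟨u, m, rfl, rfl, h1, h2⟩
    refine Finset.card_le_mul_card_image_of_maps_to
      (f := fun e => address X P i (y e)) (fun e he => ?_) K fun r _ => ?_
    · obtain ⟨u, m, h1, h2, h3, h4⟩ := key e he
      simpa [address, h1] using hdiv _ _ h4
    · rcases (S.filter fun e => address X P i (y e) = r).eq_empty_or_nonempty with h0 | ⟨e₀, he₀⟩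
      · rw [h0]; simp
      obtain ⟨he₀, hr₀⟩ := Finset.mem_filter.1 he₀
      obtain ⟨u₀, m₀, h₀, hi₀, hk₀, -⟩ := key e₀ he₀
      refine card_loc_le hP (i := i) (u := u₀) (m := m₀) _ fun e he => ?_
      obtain ⟨he, hr⟩ := Finset.mem_filter.1 he
      obtain ⟨u, m, h1, hi, hk, -⟩ := key e he
      have hm₀ := hmem _ he₀
      have hm := hmem _ he
      have hy₀ := hy _ he₀
      have hy' := hy _ he
      have ht₀ := ht _ he₀
      have ht' := ht _ he
      rw [hi₀] at hm₀ hy₀ ht₀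
      rw [hi] at hm hy' ht'
      rw [h₀] at hy₀ hr₀
      rw [h1] at hy' hr
      obtain ⟨hs₀, hf₀⟩ := loc_scope hP hm₀ hy₀ rfl
      obtain ⟨hs, hf⟩ := loc_scope hP hm hy' rfl
      -- Both declaring nodes are uncompleted when the up-pass starts, hence lie on one path. Frames
      -- on a path are disjoint, so equal addresses belong to the same variable.
      have hc := comparable_of_unfinished hP hX ((hP.isBP i).mem_of_suffix hs hm)
        ((hP.isBP i).mem_of_suffix hs₀ hm₀) (hk.trans hk₀.symm)
        (ht'.trans_le (finish_of_event hP hX hm hy' hs))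
        (ht₀.trans_le (finish_of_event hP hX hm₀ hy₀ hs₀))
      have hue : u = u₀ := by
        simp only [address] at hr hr₀
        rcases hc with hc | hc <;> rcases suffix_iff_eq_or_cons_suffix.1 hc with hc | ⟨c, hc⟩
        · exact hc.symm
        · have := stackOffset_add_frame_le (P := P) hc (hk.trans hk₀.symm)
          omega
        · exact hc
        · have := stackOffset_add_frame_le (P := P) hc (hk₀.trans hk.symm)
          omega
      subst hue
      simp only [address] at hr hr₀
      obtain rfl : m = m₀ := by omega
      exact ⟨hi, hm, hy'⟩

end order

end Execution

end PWS

namespace PWS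

namespace Execution

variable {k p K B b : ℕ} {α c₁ c₂ : ℝ} {X : Execution k p} {P : Fin k → BP}

/-! ### Nodes of small height -/

section low

variable (hP : IsBPCollection P K α c₁ c₂) (hX : X.IsWorkStealing P B b)
include hP hX

/-- During the up-pass an operation is delayed for a time `O(B b)`. -/
theorem time_succ_le (hB : 1 ≤ B) (hb : 1 ≤ b) {i : Fin k} {v : Path} (hv : v ∈ (P i).nodes)
    {ph : Phase} {j : ℕ} (hj : j < ((P i).prog v ph).length) {s : ℕ} (hs : X.upPassStart P ≤ s)
    (hjs : X.time i v ph j ≤ s) : X.time i v ph (j + 1) ≤ s + (K * B + 1) * b := by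
  classical
  obtain ⟨o, ho⟩ : ∃ o, ((P i).prog v ph)[j]? = some o := ⟨_, List.getElem?_eq_getElem hj⟩
  have hb' : b ≤ (K * B + 1) * b := Nat.le_mul_of_pos_left _ (by omega)
  by_contra! hlt
  have key : ∀ x, o.var = some x → False := by
    intro x hx
    -- Cut the delay into `K * B + 1` disjoint windows of length `b`. Each contains a completed
    -- write into the block, one more in total than `card_writes_le` allows.
    have hwin : ∀ m ∈ Finset.range (K * B + 1), ∃ e : Fin k × Path × Phase × ℕ,
        (e.2.1 ∈ (P e.1).nodes ∧ ∃ y,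
          ((P e.1).prog e.2.1 e.2.2.1)[e.2.2.2]? = some (.write y) ∧
          X.block P B e.1 y = X.block P B i x ∧
          X.upPassStart P < X.time e.1 e.2.1 e.2.2.1 (e.2.2.2 + 1)) ∧
        s + m * b < X.time e.1 e.2.1 e.2.2.1 (e.2.2.2 + 1) ∧
        X.time e.1 e.2.1 e.2.2.1 (e.2.2.2 + 1) ≤ s + m * b + b := by
      intro m hm
      have h1 : (m + 1) * b ≤ (K * B + 1) * b :=
        Nat.mul_le_mul_right _ (Finset.mem_range.1 hm)
      rw [add_mul, one_mul] at h1
      obtain ⟨i', v', ph', j', y, h2, h3, h4, -, h5, h6⟩ :=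
        hX.delay i v hv ph j o x ho hx (s + m * b) (by omega) (by omega)
      exact ⟨(i', v', ph', j'), ⟨h2, y, h3, h4, by simp only; omega⟩, h5, h6⟩
    have : Nonempty (Fin k × Path × Phase × ℕ) := ⟨(i, v, ph, j)⟩
    choose! e he h1 h2 using hwin
    have hinj : Set.InjOn e (Finset.range (K * B + 1)) := by
      intro m hm m' hm' hee
      have h3 := h1 m hm
      have h4 := h2 m hm
      have h3' := h1 m' hm'
      have h4' := h2 m' hm'
      rw [hee] at h3 h4
      by_contra hne
      rcases Nat.lt_or_gt_of_ne hne with h | h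
      · have := Nat.mul_le_mul_right b h
        rw [Nat.succ_mul] at this
        omega
      · have := Nat.mul_le_mul_right b h
        rw [Nat.succ_mul] at this
        omega
    have hcard := card_writes_le hP hX hB (X.block P B i x)
      ((Finset.range (K * B + 1)).image e) fun f hf => by
        obtain ⟨m, hm, rfl⟩ := Finset.mem_image.1 hf
        exact he m hm
    rw [Finset.card_image_of_injOn hinj, Finset.card_range] at hcard
    omega
  cases o with
  | compute =>
    have := hX.time_compute i v hv ph j ho
    omega
  | read x => exact key x rfl
  | write x => exact key x rfl

theorem finish_le (hB : 1 ≤ B) (hb : 1 ≤ b) {i : Fin k} {v : Path} (hv : v ∈ (P i).nodes)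
    {ph : Phase} {s : ℕ} (hs : X.upPassStart P ≤ s) (hvs : X.start i v ph ≤ s) :
    X.finish P i v ph ≤ s + K * ((K * B + 1) * b) := by
  have key : ∀ j ≤ ((P i).prog v ph).length, X.time i v ph j ≤ s + j * ((K * B + 1) * b) := by
    intro j
    induction j with
    | zero => intro _; simpa [start] using hvs
    | succ j ih =>
      intro hj
      have := time_succ_le hP hX hB hb hv hj (s := s + j * ((K * B + 1) * b)) (by omega)
        (ih (by omega))
      rwa [add_mul, one_mul, ← add_assoc]
  refine (key _ le_rfl).trans ?_
  gcongr
  exact (hP.isBP i).prog_length v hv ph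

theorem finish_down_le (hB : 1 ≤ B) (hb : 1 ≤ b) {i : Fin k} {v : Path} (hv : v ∈ (P i).nodes) :
    X.finish P i v .down ≤ X.upPassStart P + K * ((K * B + 1) * b) :=
  finish_le hP hX hB hb hv le_rfl (start_down_le_upPassStart hv)

/-- The factor `h + 2` counts one down phase possibly still running at `upPassStart` and the up
phases of at most `h + 1` nodes on a path. -/
theorem finish_up_le_of_height (hB : 1 ≤ B) (hb : 1 ≤ b) {i : Fin k} (h : ℕ) {v : Path}
    (hv : v ∈ (P i).nodes) (hh : (P i).depth ≤ v.length + h) :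
    X.finish P i v .up ≤ X.upPassStart P + (h + 2) * (K * ((K * B + 1) * b)) := by
  induction h generalizing v with
  | zero =>
    have hl : (P i).IsLeaf v := ⟨hv, fun hn => by
      have := BP.length_le_depth hn
      simp at this
      omega⟩
    have h1 := finish_down_le hP hX hB hb hv
    rw [← (hX.leaf_up i v hl).2] at h1
    have h2 := finish_le hP hX hB hb hv (Nat.le_add_right _ _) h1
    omega
  | succ h ih =>
    by_cases hl : false :: v ∈ (P i).nodes
    · have h1 : X.start i v .up ≤ X.upPassStart P + (h + 2) * (K * ((K * B + 1) * b)) := by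
        rw [hX.join_start i v hl]
        exact max_le (ih hl (by simp; omega))
          (ih ((hP.isBP i).child_mem true hl) (by simp; omega))
      have h2 := finish_le hP hX hB hb hv (Nat.le_add_right _ _) h1
      refine h2.trans (le_of_eq ?_)
      ring
    · have h1 := finish_down_le hP hX hB hb hv
      rw [← (hX.leaf_up i v ⟨hv, hl⟩).2] at h1
      have h2 := finish_le hP hX hB hb hv (Nat.le_add_right _ _) h1
      have h3 : 2 * (K * ((K * B + 1) * b)) ≤ (h + 1 + 2) * (K * ((K * B + 1) * b)) := by
        gcongr; omega
      omega

end low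

/-! ### Nodes of large height -/

/-- The number of operations of the up-pass computation of `w` completed in `(T, t]`. -/
def completed (X : Execution k p) (P : Fin k → BP) (i : Fin k) (T t : ℕ) (w : Path) : ℕ :=
  ((Finset.range ((P i).prog w .up).length).filter fun j =>
    T < X.time i w .up (j + 1) ∧ X.time i w .up (j + 1) ≤ t).card

/-- The number of operations completed in `(T, t]` in the up-pass computations of the
ancestors of a node (including itself) and of the siblings of these. -/
def potential (X : Execution k p) (P : Fin k → BP) (i : Fin k) (T t : ℕ) : Path → ℕ
  | [] => X.completed P i T t []
  | c :: v => potential X P i T t v + X.completed P i T t (c :: v) +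
      X.completed P i T t ((!c) :: v)

theorem completed_mono {i : Fin k} {T t t' : ℕ} (h : t ≤ t') (w : Path) :
    X.completed P i T t w ≤ X.completed P i T t' w := by
  refine Finset.card_le_card fun j hj => ?_
  rw [Finset.mem_filter] at hj ⊢
  exact ⟨hj.1, hj.2.1, hj.2.2.trans h⟩

theorem completed_lt {i : Fin k} {T t t' j : ℕ} {w : Path} (hj : j < ((P i).prog w .up).length)
    (hT : T ≤ t) (h1 : t < X.time i w .up (j + 1)) (h2 : X.time i w .up (j + 1) ≤ t') :
    X.completed P i T t w < X.completed P i T t' w := by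
  refine Finset.card_lt_card (Finset.ssubset_iff_subset_ne.2 ⟨fun l hl => ?_, fun h => ?_⟩)
  · rw [Finset.mem_filter] at hl ⊢
    exact ⟨hl.1, hl.2.1, by omega⟩
  · have : j ∈ (Finset.range ((P i).prog w .up).length).filter fun j =>
      T < X.time i w .up (j + 1) ∧ X.time i w .up (j + 1) ≤ t' := by
        rw [Finset.mem_filter, Finset.mem_range]
        omega
    rw [← h, Finset.mem_filter] at this
    omega

theorem completed_le (hP : IsBPCollection P K α c₁ c₂) {i : Fin k} {T t : ℕ} {w : Path}
    (hw : w ∈ (P i).nodes) : X.completed P i T t w ≤ K := by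
  refine (Finset.card_filter_le _ _).trans ?_
  rw [Finset.card_range]
  exact (hP.isBP i).prog_length w hw .up

theorem potential_mono {i : Fin k} {T t t' : ℕ} (h : t ≤ t') (x : Path) :
    X.potential P i T t x ≤ X.potential P i T t' x := by
  induction x with
  | nil => exact completed_mono h _
  | cons c v ih => exact add_le_add (add_le_add ih (completed_mono h _)) (completed_mono h _)

/-- Each further level adds two nodes, with at most `K` operations each. -/
theorem potential_append_le (hP : IsBPCollection P K α c₁ c₂) {i : Fin k} {T t : ℕ}
    {l v : Path} (h : l ++ v ∈ (P i).nodes) :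
    X.potential P i T t (l ++ v) ≤ X.potential P i T t v + 2 * K * l.length := by
  induction l with
  | nil => simp
  | cons c l ih =>
    have hm : l ++ v ∈ (P i).nodes := (hP.isBP i).parent_mem _ _ h
    have h1 : X.completed P i T t (c :: (l ++ v)) ≤ K := completed_le hP h
    have h2 : X.completed P i T t ((!c) :: (l ++ v)) ≤ K :=
      completed_le hP ((hP.isBP i).sibling_mem _ _ h)
    have h3 := ih hm
    rw [List.cons_append, potential, List.length_cons, mul_add]
    omega

/-- This symmetry lets a chain of delays pass into the subtree of a sibling at no cost. -/
theorem potential_sibling {i : Fin k} {T t : ℕ} {a : Path} (c d : Bool) :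
    X.potential P i T t (c :: a) = X.potential P i T t (d :: a) := by
  cases c <;> cases d <;> simp [potential] <;> omega

theorem potential_lt_of_suffix {i : Fin k} {T t t' : ℕ} (h : t ≤ t') {x y : Path} (hyx : y <:+ x)
    (hy : X.potential P i T t y < X.potential P i T t' y) :
    X.potential P i T t x < X.potential P i T t' x := by
  induction x with
  | nil => rwa [List.suffix_nil.1 hyx] at hy
  | cons c v ih =>
    rcases List.suffix_cons_iff.1 hyx with rfl | hyx
    · exact hy
    · exact add_lt_add_of_lt_of_le (add_lt_add_of_lt_of_le (ih hyx) (completed_mono h _))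
        (completed_mono h _)

theorem potential_lt_self {i : Fin k} {T t t' j : ℕ} {w : Path}
    (hj : j < ((P i).prog w .up).length) (hT : T ≤ t) (h1 : t < X.time i w .up (j + 1))
    (h2 : X.time i w .up (j + 1) ≤ t') : X.potential P i T t w < X.potential P i T t' w := by
  have h := completed_lt hj hT h1 h2
  have htt : t ≤ t' := by omega
  cases w with
  | nil => exact h
  | cons c v =>
    exact add_lt_add_of_lt_of_le (add_lt_add_of_le_of_lt (potential_mono htt _) h)
      (completed_mono htt _)

/-! ### Delays after the nodes of small height are completed -/

section high

variable (hP : IsBPCollection P K α c₁ c₂) (hX : X.IsWorkStealing P B b)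
  {H T : ℕ} (hT : X.upPassStart P ≤ T)
  (hdown : ∀ i, ∀ v ∈ (P i).nodes, X.finish P i v .down ≤ T)
  (hlow : ∀ i, ∀ v ∈ (P i).nodes, (P i).depth ≤ v.length + H → X.finish P i v .up ≤ T)
  (hbig : ∀ i, ∀ v ∈ (P i).nodes, v.length + H ≤ (P i).depth → ∀ c, B ≤ (P i).subtreeCard (c :: v))
include hP hX hdown hlow hbig

omit hdown in
/-- Once the nodes of small height are completed, no write of another core delays an access to
the global memory in the up-pass. -/
theorem not_interfere_glob {i : Fin k} {x : Path} {j : ℕ} (hB : 1 ≤ B) (hx : x ∈ (P i).nodes)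
    {o : Op} (ho : ((P i).prog x .up)[j]? = some o) {a : ℕ} (hoa : o.var = some (.glob a)) {t : ℕ}
    (hTt : T ≤ t) (hjt : X.time i x .up j ≤ t) (htj : t < X.time i x .up (j + 1)) {i' : Fin k}
    {v : Path} (hv : v ∈ (P i').nodes) {j' : ℕ} {a' : ℕ}
    (ho' : ((P i').prog v .up)[j']? = some (.write (.glob a'))) (haa : a' / B = a / B)
    (hcore : X.core i' v .up ≠ X.core i x .up) (htv : t < X.time i' v .up (j' + 1)) : False := by
  obtain ⟨hj, -⟩ := List.getElem?_eq_some_iff.1 ho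
  obtain ⟨hj', -⟩ := List.getElem?_eq_some_iff.1 ho'
  have hxf := time_succ_le_finish hX hx hj
  have hvf := time_succ_le_finish hX hv hj'
  have hxh : x.length + H < (P i).depth := by
    by_contra! h
    have := hlow i x hx h
    omega
  have hvh : v.length + H < (P i').depth := by
    by_contra! h
    have := hlow i' v hv h
    omega
  have h1 : a < a' + B := by
    have := Nat.lt_div_mul_add (a := a) hB
    have := Nat.div_mul_le_self a' B
    rw [haa] at this
    omega
  have h2 : a' < a + B := by
    have := Nat.lt_div_mul_add (a := a') hB
    have := Nat.div_mul_le_self a B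
    rw [← haa] at this
    omega
  have hw' := hP.up_write i' v hv a' (List.mem_of_getElem? ho')
  -- Used with `z` equal to `x` or a child of `x`. The written word is reserved for the subtree of
  -- `z`, so a writer in the same tree is `x` itself, on the same core, or was completed before the
  -- up phase of `x` began.
  have key : ∀ z ∈ (P i).nodes, x <:+ z → z.length + H ≤ (P i).depth → a ∈ (P i).outWords z →
      False := by
    intro z hz hxz hzh haz
    obtain ⟨h3, h4⟩ := (hP.isBP i).near_outWords hz (hbig i z hz hzh) haz h1 h2
    by_cases hi : i' = i
    · subst hi
      have h5 := hxz.trans ((hP.isBP i').suffix_of_mem_outWords hz hv hw' h3 h4)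
      rcases suffix_iff_eq_or_cons_suffix.1 h5 with rfl | ⟨c, h5⟩
      · exact hcore rfl
      · have h6 := finish_up_le_start_up hP hX h5 hv
        have h7 := start_le hX hx hj.le
        omega
    · exact Set.disjoint_left.1 (hP.disjoint_out i' i hi) ((hP.isBP i').mem_outArray hv hw')
        ((hP.isBP i).outWords_subset_outArray hz h3 h4)
  have hread : a ∈ (P i).outWords x ∨
      (∃ c, c :: x ∈ (P i).nodes ∧ a ∈ (P i).outWords (c :: x)) ∨ ∀ i', a ∉ (P i').outArray := by
    cases o with
    | compute => simp [Op.var] at hoa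
    | read y =>
      obtain rfl : y = .glob a := by simpa [Op.var] using hoa
      exact hP.up_read i x hx a (List.mem_of_getElem? ho)
    | write y =>
      obtain rfl : y = .glob a := by simpa [Op.var] using hoa
      exact .inl (hP.up_write i x hx a (List.mem_of_getElem? ho))
  rcases hread with h | ⟨c, hc, h⟩ | h
  · exact key x hx List.suffix_rfl hxh.le h
  · exact key _ hc (List.suffix_cons c x) (by simp; omega) h
  -- With the roles exchanged: the word read is so close to an output word of `v` that it lies in an
  -- output array.
  · obtain ⟨h3, h4⟩ := (hP.isBP i').near_outWords hv (hbig i' v hv hvh.le) hw' h2 h1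
    exact h i' ((hP.isBP i').outWords_subset_outArray hv h3 h4)

include hT in
/-- Once the nodes of small height are completed, an operation of the up-pass at `x` is delayed
only by siblings of ancestors of `x` and by descendants of the sibling of `x`. -/
theorem interfere {i : Fin k} {x : Path} {j : ℕ} (hB : 1 ≤ B) (hx : x ∈ (P i).nodes)
    {o : Op} (ho : ((P i).prog x .up)[j]? = some o) {z : Var} (hoz : o.var = some z) {t t' : ℕ}
    (hTt : T ≤ t) (hjt : X.time i x .up j ≤ t) (htj : t' < X.time i x .up (j + 1)) {i' : Fin k}
    {v : Path} (hv : v ∈ (P i').nodes) {ph : Phase} {j' : ℕ} {y : Var}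
    (ho' : ((P i').prog v ph)[j']? = some (.write y)) (hyz : X.block P B i' y = X.block P B i z)
    (hcore : X.core i' v ph ≠ X.core i x .up) (htv : t < X.time i' v ph (j' + 1))
    (htv' : X.time i' v ph (j' + 1) ≤ t') :
    i' = i ∧ ph = .up ∧ ((∃ c d a, v = c :: a ∧ d :: a <:+ x) ∨
      ∃ c w, x = c :: w ∧ w <:+ v ∧ x.length < v.length) := by
  obtain ⟨hj, -⟩ := List.getElem?_eq_some_iff.1 ho
  obtain ⟨hj', -⟩ := List.getElem?_eq_some_iff.1 ho'
  have hxf := time_succ_le_finish hX hx hj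
  have hvf := time_succ_le_finish hX hv hj'
  obtain rfl : ph = .up := by
    cases ph
    · have := hdown i' v hv
      omega
    · rfl
  cases z with
  | glob a =>
    cases y with
    | loc u m => simp [block] at hyz
    | glob a' =>
      exact (not_interfere_glob hP hX hlow hbig hB hx ho hoz hTt hjt (by omega) hv ho'
        (by simpa [block] using hyz) hcore htv).elim
  | loc u m =>
    cases y with
    | glob a' => simp [block] at hyz
    | loc u' m' =>
      simp only [block, Block.stack.injEq] at hyz
      obtain ⟨rfl, hk, -⟩ := hyz
      refine ⟨rfl, rfl, ?_⟩
      have hsx := (loc_scope hP hx ho hoz).1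
      have hsv := (loc_scope hP hv ho' rfl).1
      have hcomp := comparable_of_unfinished hP hX ((hP.isBP i').mem_of_suffix hsv hv)
        ((hP.isBP i').mem_of_suffix hsx hx) hk
        (lt_of_lt_of_le (by omega) (finish_of_event hP hX hv ho' hsv))
        (lt_of_lt_of_le (by omega) (finish_of_event hP hX hx ho hsx))
      have hu : u = x ∨ u = x.tail :=
        ((hP.isBP i').up_scope x hx o (List.mem_of_getElem? ho) u m hoz).1
      have hu' : u' = v ∨ u' = v.tail :=
        ((hP.isBP i').up_scope v hv _ (List.mem_of_getElem? ho') u' m' rfl).1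
      have hxj := start_le hX hx hj.le
      have hvj := start_le hX hv hj'.le
      have hvt := hX.time_lt i' v hv .up j' hj'
      -- Comparable distinct nodes are never in their up phases together, so the two paths must
      -- branch.
      rcases suffix_or_diverge x v with h | h | ⟨c, w, h1, h2⟩
      · rcases suffix_iff_eq_or_cons_suffix.1 h with rfl | ⟨c, h⟩
        · exact (hcore rfl).elim
        · have := finish_up_le_start_up hP hX h hv
          omega
      · rcases suffix_iff_eq_or_cons_suffix.1 h with rfl | ⟨c, h⟩
        · exact (hcore rfl).elim
        · have := finish_up_le_start_up hP hX h hx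
          omega
      · rcases suffix_iff_eq_or_cons_suffix.1 h2 with rfl | ⟨d, h3⟩
        · exact .inl ⟨!c, c, w, rfl, h1⟩
        -- The variable written by `v` is declared inside the other branch. The variable accessed by
        -- `x` is comparable with it, hence declared at or above `w`, so `x` is a child of `w`
        -- accessing its parent's frame.
        · right
          have hv' : (!c) :: w <:+ u' := by
            rcases hu' with rfl | rfl
            · exact h2
            · cases v with
              | nil => simp at h3
              | cons e v =>
                rcases List.suffix_cons_iff.1 h2 with h4 | h4
                · rw [← h4] at h3
                  exact (not_cons_suffix_self h3).elim
                · exact h4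
          have hnot : ¬ c :: w <:+ u := by
            intro hcu
            rcases hcomp with h | h
            · simpa using eq_of_cons_suffix hcu (hv'.trans h)
            · simpa using eq_of_cons_suffix (hcu.trans h) hv'
          have hxw : x = c :: w := by
            cases x with
            | nil => simp at h1
            | cons e x =>
              rcases List.suffix_cons_iff.1 h1 with h4 | h4
              · exact h4.symm
              · rcases hu with rfl | rfl
                · exact (hnot h1).elim
                · exact (hnot h4).elim
          refine ⟨c, w, hxw, (List.suffix_cons _ _).trans h2, ?_⟩
          have := h3.length_le
          rw [hxw]
          simp at this ⊢
          omega

include hT in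
-- Follow the causes of delay backwards from `x` at time `t`. Each step goes back at most `b` and
-- must lower the budget by at least 1. Staying at `x` lowers the potential. Going `l` levels deeper
-- may add `2 * K * l` to the potential, but the level term drops by `(2 * K + 1) * l`.
theorem time_le_potential (hB : 1 ≤ B) (hb : 1 ≤ b) (t : ℕ) {i : Fin k} {x : Path}
    (hx : x ∈ (P i).nodes) (h1 : X.start i x .up ≤ t) (h2 : t < X.finish P i x .up) :
    t + b * ((2 * K + 1) * x.length) ≤
      T + b * ((2 * K + 1) * (P i).depth + X.potential P i T t x + 1) := by
  have step : ∀ {t t' M M' N N' : ℕ}, t' + b * M' ≤ T + b * N' → t ≤ t' + b →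
      M + N' + 1 ≤ M' + N → t + b * M ≤ T + b * N := by
    intro t t' M M' N N' h ht hMN
    have := Nat.mul_le_mul_left b hMN
    simp only [mul_add, mul_one] at this
    omega
  induction t using Nat.strong_induction_on generalizing x with
  | _ t ih =>
  have hdx := Nat.mul_le_mul_left (2 * K + 1) (BP.length_le_depth hx)
  by_cases h0 : t < T + b
  · exact step (t' := T) (M' := 0) (N' := 0) (by simp) h0.le (by omega)
  have hjump : ∀ t' < t, t ≤ t' + b → ∀ l w c d, x = c :: w → l ++ d :: w ∈ (P i).nodes →
      X.start i (l ++ d :: w) .up ≤ t' → t' < X.finish P i (l ++ d :: w) .up → 0 < l.length →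
      t + b * ((2 * K + 1) * x.length) ≤
        T + b * ((2 * K + 1) * (P i).depth + X.potential P i T t x + 1) := by
    rintro t' ht' htb l w c d rfl hm hs hf hl
    have hpot := potential_append_le (X := X) hP (T := T) (t := t') hm
    have hpot' := potential_mono (X := X) (P := P) (i := i) (T := T) ht'.le (d :: w)
    rw [potential_sibling d c] at hpot hpot'
    refine step (ih t' ht' hm hs hf) htb ?_
    rw [potential_sibling d c] at hpot'
    have e : (2 * K + 1) * (l ++ d :: w).length =
      (2 * K + 1) * (c :: w).length + 2 * K * l.length + l.length := by simp; ring
    omega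
  obtain ⟨j, hj, hj1, hj2⟩ : ∃ j < ((P i).prog x .up).length,
      X.time i x .up j ≤ t ∧ t < X.time i x .up (j + 1) := by
    by_contra! hcon
    have : ∀ j ≤ ((P i).prog x .up).length, X.time i x .up j ≤ t := by
      intro j
      induction j with
      | zero => exact fun _ => h1
      | succ j ihj => exact fun hj => hcon j hj (ihj (by omega))
    exact absurd h2 (not_lt.2 (this _ le_rfl))
  have hback : ∀ t' < t, t ≤ t' + b → X.start i x .up ≤ t' →
      X.potential P i T t' x < X.potential P i T t x →
      t + b * ((2 * K + 1) * x.length) ≤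
        T + b * ((2 * K + 1) * (P i).depth + X.potential P i T t x + 1) :=
    fun t' ht' htb hs hpot => step (ih t' ht' hx hs (ht'.trans h2)) htb (by omega)
  -- Either the current operation has waited for `b` units, and a write by another core is to blame,
  -- or it began less than `b` ago, and its predecessor (an operation of `x` or the completion of a
  -- child) is used.
  by_cases hw : X.time i x .up j + b ≤ t
  · obtain ⟨o, ho⟩ : ∃ o, ((P i).prog x .up)[j]? = some o := ⟨_, List.getElem?_eq_getElem hj⟩
    have key : ∀ z, o.var = some z → t + b * ((2 * K + 1) * x.length) ≤
        T + b * ((2 * K + 1) * (P i).depth + X.potential P i T t x + 1) := by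
      intro z hz
      obtain ⟨i', v, ph, j', y, hv, ho', hyz, hcore, hv1, hv2⟩ :=
        hX.delay i x hx .up j o z ho hz (t - b) (by omega) (by omega)
      rw [Nat.sub_add_cancel (by omega)] at hv2
      obtain ⟨rfl, rfl, hcase⟩ := interfere hP hX hT hdown hlow hbig hB hx ho hz
        (t := t - b) (t' := t) (by omega) (by omega) hj2 hv ho' hyz hcore hv1 hv2
      obtain ⟨hj', -⟩ := List.getElem?_eq_some_iff.1 ho'
      rcases hcase with ⟨c, d, a, rfl, hax⟩ | ⟨c, w, hxw, hwv, hlen⟩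
      · refine hback (t - b) (by omega) (by omega) ?_ ?_
        · have := start_le hX hx hj.le
          omega
        -- The writer is a node counted by the potential, which therefore grew during `(t - b, t]`.
        · refine potential_lt_of_suffix (by omega) hax ?_
          rw [potential_sibling d c, potential_sibling d c]
          exact potential_lt_self hj' (by omega) hv1 hv2
      · have h3 := start_le hX hv hj'.le
        have h4 := hX.time_lt i' v hv .up j' hj'
        have h5 := time_succ_le_finish hX hv hj'
        rcases suffix_iff_eq_or_cons_suffix.1 hwv with rfl | ⟨d, l, rfl⟩
        · rw [hxw] at hlen
          simp at hlen
        -- One unit before the write completes, the writer is certainly in its up phase, as the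
        -- induction hypothesis requires.
        · refine hjump (X.time i' (l ++ d :: w) .up (j' + 1) - 1) (by omega) (by omega) l w c d hxw
            hv (by omega) (by omega) ?_
          rw [hxw] at hlen
          simp at hlen
          omega
    cases o with
    | compute =>
      have := hX.time_compute i x hx .up j ho
      omega
    | read z => exact key z rfl
    | write z => exact key z rfl
  · rcases Nat.eq_zero_or_pos j with rfl | hj0
    · change ¬ X.start i x .up + b ≤ t at hw
      by_cases hl : false :: x ∈ (P i).nodes
      · obtain ⟨c, hc, hs⟩ : ∃ c, c :: x ∈ (P i).nodes ∧
            X.start i x .up = X.finish P i (c :: x) .up := by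
          rw [hX.join_start i x hl]
          rcases max_choice (X.finish P i (false :: x) .up) (X.finish P i (true :: x) .up) with h | h
          · exact ⟨false, hl, h⟩
          · exact ⟨true, (hP.isBP i).child_mem true hl, h⟩
        have h3 := start_lt_finish hP hX hc .up
        have ht' : X.start i x .up - 1 < t := by omega
        have hpot := potential_append_le (X := X) hP (T := T) (t := X.start i x .up - 1)
          (l := [c]) (v := x) hc
        have hpot' := potential_mono (X := X) (P := P) (i := i) (T := T) ht'.le x
        refine step (ih _ ht' hc (by omega) (by omega)) (by omega) ?_
        simp only [List.cons_append, List.nil_append, List.length_cons, List.length_nil, mul_add,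
          mul_one] at hpot ⊢
        omega
      · have h3 := (hX.leaf_up i x ⟨hx, hl⟩).2
        have h4 := hdown i x hx
        omega
    · obtain ⟨m, rfl⟩ : ∃ m, j = m + 1 := ⟨j - 1, by omega⟩
      have h3 := hX.time_lt i x hx .up m (by omega)
      have h4 := start_le hX hx (ph := .up) (j := m) (by omega)
      exact hback (X.time i x .up (m + 1) - 1) (by omega) (by omega) (by omega)
        (potential_lt_self (j := m) (by omega) (by omega) (by omega) (by omega))

include hT in
theorem completion_le {L : ℕ} (hL : ∀ i, (P i).depth ≤ L) (hB : 1 ≤ B) (hb : 1 ≤ b) :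
    X.completion P ≤ T + b * ((2 * K + 1) * L + K + 2) := by
  refine Finset.sup_le fun i _ => Finset.sup_le fun v hv => ?_
  refine (finish_up_mono hP hX List.nil_suffix hv).trans ?_
  have hr := (hP.isBP i).root_mem
  have h1 := start_lt_finish hP hX hr .up
  have h2 := time_le_potential hP hX hT hdown hlow hbig hB hb (X.finish P i [] .up - 1) hr
    (by omega) (by omega)
  have h3 : X.potential P i T (X.finish P i [] .up - 1) [] ≤ K := completed_le hP hr
  have h4 : b * ((2 * K + 1) * (P i).depth + X.potential P i T (X.finish P i [] .up - 1) [] + 1) ≤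
      b * ((2 * K + 1) * L + K + 1) := by
    gcongr
    exact hL i
  simp only [mul_add, mul_one] at h2 h4 ⊢
  omega

end high

end Execution

end PWS

namespace PWS

namespace Execution

variable {k p K B b : ℕ} {α c₁ c₂ : ℝ} {X : Execution k p} {P : Fin k → BP}

/-! ### Continuity of the work on a kernel -/

section kernel

variable (hP : IsBPCollection P K α c₁ c₂) (hX : X.IsWorkStealing P B b)

theorem kernelRoot_kernelRoot (i : Fin k) (u : Path) :
    X.kernelRoot i (X.kernelRoot i u) = X.kernelRoot i u :=
  (kernelRoot_eq_of_between List.suffix_rfl (X.kernelRoot_suffix i u)).symm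

include hX in
/-- If a right child is not stolen, then nothing is stolen from the subtree of its sibling. -/
theorem kernelRoot_eq_of_kept {i : Fin k} {v u : Path} (hl : false :: v ∈ (P i).nodes)
    (hs : X.stolen i (true :: v) = false) (hu : u ∈ (P i).nodes) (h : false :: v <:+ u)
    (hP : IsBPCollection P K α c₁ c₂) : X.kernelRoot i u = X.kernelRoot i (false :: v) := by
  obtain ⟨l, rfl⟩ := h
  induction l with
  | nil => rfl
  | cons a l ih =>
    have hm : l ++ false :: v ∈ (P i).nodes := (hP.isBP i).parent_mem _ _ hu
    have hk : X.kernelRoot i (false :: v) = X.kernelRoot i v := by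
      rw [kernelRoot, (hX.left i v hl).1]
      simp
    rw [List.cons_append, kernelRoot]
    split
    · rename_i hst
      -- Steals are from the top of the queue, so the right child of `v` would have had to be stolen
      -- earlier.
      have := (hX.steal_top i v (a :: (l ++ false :: v)) hu hst
        ⟨a :: l, rfl⟩ ((ih hm).trans hk)).1
      rw [hs] at this
      cases this
    · exact ih hm

include hP hX

/-- A core executes a subtree from which nothing is stolen without interruption. -/
theorem executes_of_unstolen {i : Fin k} : ∀ v ∈ (P i).nodes,
    (∀ u ∈ (P i).nodes, v <:+ u → X.kernelRoot i u = X.kernelRoot i v) →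
    X.core i v .up = X.core i v .down ∧ ∀ t, X.start i v .down ≤ t → t < X.finish P i v .up →
      ∃ u ph, X.kernelRoot i u = X.kernelRoot i v ∧ X.Executes P (X.core i v .down) t i u ph := by
  refine BP.induction_up fun v hv ih hk => ?_
  by_cases hl : false :: v ∈ (P i).nodes
  · have hr := (hP.isBP i).child_mem true hl
    have hkl := hk _ hl (List.suffix_cons _ _)
    have hkr := hk _ hr (List.suffix_cons _ _)
    obtain ⟨hl1, hl2⟩ := ih _ hl fun u hu hs =>
      (hk u hu ((List.suffix_cons _ _).trans hs)).trans hkl.symm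
    obtain ⟨hr1, hr2⟩ := ih _ hr fun u hu hs =>
      (hk u hu ((List.suffix_cons _ _).trans hs)).trans hkr.symm
    have hrs : X.stolen i (true :: v) = false :=
      stolen_eq_false (hkr ▸ X.kernelRoot_suffix i v) List.suffix_rfl
    obtain ⟨-, hlc, hlt⟩ := hX.left i v hl
    obtain ⟨-, hrc, hrt⟩ := hX.right_kept i v hr hrs
    have hlt' := start_down_lt_finish_up hP hX hl
    have hrt' := start_down_lt_finish_up hP hX hr
    have hj : X.start i v .up = X.finish P i (true :: v) .up := by
      rw [hX.join_start i v hl, max_eq_right (by omega)]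
    have hc : X.core i v .up = X.core i v .down := by
      obtain ⟨c, hc1, hc2⟩ := hX.join_core i v hl
      cases c
      · simp only [Bool.not_false] at hc2
        omega
      · rw [hc1, hr1, hrc]
    rw [hkl, hlc] at hl2
    rw [hkr, hrc] at hr2
    refine ⟨hc, fun t h1 h2 => ?_⟩
    by_cases ht1 : t < X.finish P i v .down
    · exact ⟨v, .down, rfl, hv, rfl, h1, ht1⟩
    by_cases ht2 : t < X.finish P i (false :: v) .up
    · exact hl2 t (by omega) ht2
    by_cases ht3 : t < X.finish P i (true :: v) .up
    · exact hr2 t (by omega) ht3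
    · exact ⟨v, .up, rfl, hv, hc, by omega, h2⟩
  · obtain ⟨hc, ht⟩ := hX.leaf_up i v ⟨hv, hl⟩
    refine ⟨hc, fun t h1 h2 => ?_⟩
    by_cases ht1 : t < X.finish P i v .down
    · exact ⟨v, .down, rfl, hv, rfl, h1, ht1⟩
    · exact ⟨v, .up, rfl, hv, hc, by omega, h2⟩

/-- The down-pass of a kernel is executed by one core without interruption. -/
theorem executes_kernel {i : Fin k} {u : Path} (hu : u ∈ (P i).nodes) :
    X.core i u .down = X.core i (X.kernelRoot i u) .down ∧
      ∀ t, X.start i (X.kernelRoot i u) .down ≤ t → t < X.finish P i u .down →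
        ∃ w ph, X.kernelRoot i w = X.kernelRoot i u ∧
          X.Executes P (X.core i (X.kernelRoot i u) .down) t i w ph := by
  induction u with
  | nil => exact ⟨rfl, fun t h1 h2 => ⟨[], .down, rfl, hu, rfl, h1, h2⟩⟩
  | cons c v ih =>
    cases hs : X.stolen i (c :: v)
    · have hk : X.kernelRoot i (c :: v) = X.kernelRoot i v := by rw [kernelRoot, hs]; simp
      obtain ⟨ih1, ih2⟩ := ih ((hP.isBP i).parent_mem _ _ hu)
      have hl := (hP.isBP i).child_mem false hu
      obtain ⟨hls, hlc, hlt⟩ := hX.left i v hl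
      have hc : X.core i (c :: v) .down = X.core i v .down := by
        cases c
        · exact hlc
        · exact (hX.right_kept i v hu hs).2.1
      rw [hk]
      refine ⟨hc.trans ih1, fun t h1 h2 => ?_⟩
      by_cases ht1 : t < X.finish P i v .down
      · exact ih2 t h1 ht1
      by_cases ht2 : X.start i (c :: v) .down ≤ t
      · exact ⟨c :: v, .down, hk, hu, hc.trans ih1, ht2, h2⟩
      cases c
      · omega
      -- Between the fork and the start of a kept right child, the core is busy in the left subtree,
      -- from which nothing is stolen.
      · have hrt := (hX.right_kept i v hu hs).2.2
        have hlk : X.kernelRoot i (false :: v) = X.kernelRoot i v := by rw [kernelRoot, hls]; simp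
        have := (executes_of_unstolen hP hX (false :: v) hl fun u hu h =>
          kernelRoot_eq_of_kept hX hl hs hu h hP).2 t (by omega) (by omega)
        rwa [hlk, hlc, ih1] at this
    · have hk : X.kernelRoot i (c :: v) = c :: v := by rw [kernelRoot, hs]; simp
      rw [hk]
      exact ⟨rfl, fun t h1 h2 => ⟨c :: v, .down, hk, hu, rfl, h1, h2⟩⟩

/-- If `u` forked before the later kernel began, the right child of `u` was still queued then,
contrary to `queue_empty`. Otherwise that kernel begins while the core is continuously executing the
kernel of `u`, so by `exclusive` the kernels agree. -/
theorem kernelRoot_eq_of_start_le {i : Fin k} {u v : Path} {t : ℕ} (hu : true :: u ∈ (P i).nodes)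
    (hv : true :: v ∈ (P i).nodes) (hvt : X.finish P i v .down ≤ t)
    (hut' : t ≤ X.start i (true :: u) .down) (hc : X.core i u .down = X.core i v .down)
    (h : X.start i (X.kernelRoot i u) .down ≤ X.start i (X.kernelRoot i v) .down) :
    X.kernelRoot i u = X.kernelRoot i v := by
  have hum := (hP.isBP i).parent_mem _ _ hu
  have hvm := (hP.isBP i).parent_mem _ _ hv
  have hks := X.kernelRoot_suffix i v
  have hkm := (hP.isBP i).mem_of_suffix hks hvm
  obtain ⟨huc, hux⟩ := executes_kernel hP hX hum
  have hvc := (executes_kernel hP hX hvm).1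
  by_cases hf : X.finish P i u .down ≤ X.start i (X.kernelRoot i v) .down
  · have h1 := hX.queue_empty i _ hkm (stolen_of_kernelRoot v) i u hu (hc.trans hvc) hf
    have h2 := start_down_mono hP hX hks hvm
    have h3 := start_lt_finish hP hX hvm .down
    omega
  · obtain ⟨w, ph, hw, hx⟩ := hux _ h (by omega)
    rw [← huc, hc, hvc] at hx
    have hx' : X.Executes P (X.core i (X.kernelRoot i v) .down)
        (X.start i (X.kernelRoot i v) .down) i (X.kernelRoot i v) .down :=
      ⟨hkm, rfl, le_rfl, start_lt_finish hP hX hkm .down⟩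
    obtain ⟨-, rfl, -⟩ := hX.exclusive _ _ _ _ _ _ _ _ hx hx'
    rw [← hw, kernelRoot_kernelRoot]

/-- The left branch, which contains the right child of `u`, is completed before `v` in the right
branch starts; yet this child has not started before `v` forks. -/
theorem not_diverge_of_queued {i : Fin k} {u v w : Path} {t : ℕ} (hu : true :: u ∈ (P i).nodes)
    (hv : v ∈ (P i).nodes) (hvt : X.finish P i v .down ≤ t)
    (hut' : t ≤ X.start i (true :: u) .down) (hk : X.kernelRoot i u = X.kernelRoot i v)
    (h1 : false :: w <:+ u) (h2 : true :: w <:+ v) : False := by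
  have hum := (hP.isBP i).parent_mem _ _ hu
  have h3 := finish_up_le_of_diverge hP hX hum hv hk h1 h2
  have h4 := start_down_mono hP hX h2 hv
  have h5 := start_lt_finish hP hX hv .down
  have h6 := start_down_lt_finish_up hP hX hu
  have h7 := finish_up_mono hP hX (List.suffix_cons _ _) hu
  omega

/-- The tasks that are on the task queue of a core at the same time have different levels. -/
theorem eq_of_queued {i : Fin k} {u v : Path} {t : ℕ} (hu : true :: u ∈ (P i).nodes)
    (hv : true :: v ∈ (P i).nodes) (hut : X.finish P i u .down ≤ t)
    (hvt : X.finish P i v .down ≤ t) (hut' : t ≤ X.start i (true :: u) .down)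
    (hvt' : t ≤ X.start i (true :: v) .down) (hc : X.core i u .down = X.core i v .down)
    (hlen : u.length = v.length) : u = v := by
  have hk : X.kernelRoot i u = X.kernelRoot i v := by
    rcases le_total (X.start i (X.kernelRoot i u) .down) (X.start i (X.kernelRoot i v) .down)
      with h | h
    · exact kernelRoot_eq_of_start_le hP hX hu hv hvt hut' hc h
    · exact (kernelRoot_eq_of_start_le hP hX hv hu hut hvt' hc.symm h).symm
  rcases suffix_or_diverge u v with h | h | ⟨c, w, h1, h2⟩
  · exact h.eq_of_length hlen
  · exact (h.eq_of_length hlen.symm).symm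
  · cases c
    · exact (not_diverge_of_queued hP hX hu ((hP.isBP i).parent_mem _ _ hv) hvt hut' hk h1 h2).elim
    · exact (not_diverge_of_queued hP hX hv ((hP.isBP i).parent_mem _ _ hu) hut hvt' hk.symm
        h2 h1).elim

/-- A core without work resumes work only by starting a stolen task. -/
theorem exists_stolen_of_working (hroot : ∀ i, X.start i [] .down = 0) {c : Fin p} {t : ℕ}
    (h1 : ¬ X.Working P c t) (h2 : X.Working P c (t + 1)) :
    ∃ i, ∃ s ∈ (P i).nodes, X.stolen i s = true ∧ X.core i s .down = c ∧
      X.start i s .down = t + 1 := by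
  obtain ⟨i, v, ph, hv, hc, hs, hf⟩ := h2
  have hst : X.start i v ph = t + 1 := by
    by_contra hne
    exact h1 ⟨i, v, ph, hv, hc, by omega, by omega⟩
  have hprev : ∀ u ∈ (P i).nodes, ∀ ph', X.core i u ph' = c → X.finish P i u ph' = t + 1 →
      False := by
    intro u hu ph' hcu hfu
    have := start_lt_finish hP hX hu ph'
    exact h1 ⟨i, u, ph', hu, hcu, by omega, by omega⟩
  cases ph with
  | down =>
    cases v with
    | nil => have := hroot i; omega
    | cons d v =>
      have hvm := (hP.isBP i).parent_mem _ _ hv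
      cases d
      · obtain ⟨-, h3, h4⟩ := hX.left i v hv
        exact (hprev v hvm .down (h3 ▸ hc) (h4 ▸ hst)).elim
      · cases hst' : X.stolen i (true :: v)
        · obtain ⟨h3, h4, h5⟩ := hX.right_kept i v hv hst'
          exact (hprev _ ((hP.isBP i).child_mem false hv) .up (by rw [h3, ← h4, hc])
            (h5 ▸ hst)).elim
        · exact ⟨i, _, hv, hst', hc, hst⟩
  | up =>
    by_cases hl : false :: v ∈ (P i).nodes
    · obtain ⟨d, h3, h4⟩ := hX.join_core i v hl
      have h5 := hX.join_start i v hl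
      refine (hprev (d :: v) ((hP.isBP i).child_mem d hl) .up (h3 ▸ hc) ?_).elim
      cases d
      · simp only [Bool.not_false] at h4
        rw [max_eq_left h4] at h5
        omega
      · simp only [Bool.not_true] at h4
        rw [max_eq_right h4] at h5
        omega
    · obtain ⟨h3, h4⟩ := hX.leaf_up i v ⟨hv, hl⟩
      exact (hprev v hv .down (h3 ▸ hc) (h4 ▸ hst)).elim

end kernel

/-! ### The total time without work -/

theorem idleCores_eq [∀ c t, Decidable (X.Working P c t)] (t : ℕ) :
    X.idleCores P t = (Finset.univ.filter fun c => ¬ X.Working P c t).card := by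
  rw [idleCores, ← Set.ncard_coe_finset]
  simp

theorem idleCores_le (t : ℕ) : X.idleCores P t ≤ p := by
  classical
  rw [idleCores_eq]
  simpa using Finset.card_filter_le (Finset.univ : Finset (Fin p)) fun c => ¬ X.Working P c t

theorem upPassIdleTime_le : X.upPassIdleTime P ≤ p * (X.completion P - X.upPassStart P) := by
  refine (Finset.sum_le_card_nsmul _ _ p fun t _ => idleCores_le t).trans ?_
  rw [Nat.card_Ico, smul_eq_mul, mul_comm]

theorem idleTime_le : X.idleTime P ≤
    ∑ t ∈ Finset.range (X.upPassStart P), X.idleCores P t + X.upPassIdleTime P := by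
  classical
  rw [idleTime, upPassIdleTime, ← Finset.sum_union]
  · refine Finset.sum_le_sum_of_subset fun t ht => ?_
    simp only [Finset.mem_union, Finset.mem_range, Finset.mem_Ico] at ht ⊢
    omega
  · rw [Finset.disjoint_left]
    intro t h1 h2
    simp only [Finset.mem_range, Finset.mem_Ico] at h1 h2
    omega

end Execution

/-! ### Steal attempts in the down-pass under priority work stealing -/

section pws

variable {p K B b sP : ℕ} {α c₁ c₂ : ℝ} {X : Execution 1 p} {P : BP} {round : ℕ → ℕ}

theorem IsPWS.round_le (hX : IsPWS X P round sP) {t : ℕ}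
    (ht : t < X.upPassStart fun _ => P) : round t ≤ P.depth := by
  by_contra! h
  refine absurd ht (not_lt.2 (Finset.sup_le fun i _ => Finset.sup_le fun v hv => ?_))
  rw [Fin.fin_one_eq_zero i]
  exact hX.round_queues t v hv ((BP.length_le_depth hv).trans_lt h)

/-- At the earlier of the two start times the round is already the common level. Both parents have
forked by then, so both tasks are on the same queue and `eq_of_queued` applies. -/
theorem IsPWS.eq_of_stolen (hP : IsBPCollection (fun _ : Fin 1 => P) K α c₁ c₂)
    (hW : X.IsWorkStealing (fun _ => P) B b) (hX : IsPWS X P round sP) {s s' : Path}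
    (hs : s ∈ P.nodes) (hs' : s' ∈ P.nodes) (hst : X.stolen 0 s = true)
    (hst' : X.stolen 0 s' = true) (hlen : s.length = s'.length)
    (hc : X.core 0 s.tail .down = X.core 0 s'.tail .down) : s = s' := by
  have shape : ∀ {s}, s ∈ P.nodes → X.stolen 0 s = true → ∃ u, s = true :: u := by
    intro s hs hst
    cases s with
    | nil => simp [hW.root_not_stolen 0] at hst
    | cons c u =>
      cases c
      · simp [(hW.left 0 u hs).1] at hst
      · exact ⟨u, rfl⟩
  obtain ⟨u, rfl⟩ := shape hs hst
  obtain ⟨v, rfl⟩ := shape hs' hst'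
  have hr := hX.steal_round _ hs hst
  have hr' := hX.steal_round _ hs' hst'
  simp only [List.length_cons, Nat.add_right_cancel_iff] at hlen hr hr'
  have hmin : round (min (X.start 0 (true :: u) .down) (X.start 0 (true :: v) .down)) =
      u.length + 1 := by
    rcases min_choice (X.start 0 (true :: u) .down) (X.start 0 (true :: v) .down) with h | h <;>
      rw [h] <;> omega
  have hl := (hP.isBP 0).child_mem false hs
  have hl' := (hP.isBP 0).child_mem false hs'
  rw [Execution.eq_of_queued hP hW hs hs' (hX.round_forks _ u hl (by omega))
    (hX.round_forks _ v hl' (by omega)) (min_le_left _ _) (min_le_right _ _) hc hlen]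

/-- Under priority work stealing, the total time without work in the down-pass. -/
theorem IsPWS.sum_idleCores_le (hP : IsBPCollection (fun _ : Fin 1 => P) K α c₁ c₂)
    (hW : X.IsWorkStealing (fun _ => P) B b) (hX : IsPWS X P round sP) :
    ∑ t ∈ Finset.range (X.upPassStart fun _ => P), X.idleCores (fun _ => P) t ≤
      sP * (2 * (p * (P.depth + 1))) := by
  classical
  set T := X.upPassStart fun _ => P with hT
  set S : Finset (Fin p × ℕ) := (Finset.univ ×ˢ Finset.range T).filter
    fun x => ¬ X.Working (fun _ => P) x.1 x.2 with hS
  have hmem : ∀ c t, (c, t) ∈ S ↔ t < T ∧ ¬ X.Working (fun _ => P) c t := by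
    intro c t
    simp [hS]
  have hcard : ∑ t ∈ Finset.range T, X.idleCores (fun _ => P) t = S.card := by
    rw [hS, Finset.card_filter, Finset.sum_product_right]
    exact Finset.sum_congr rfl fun t _ => by rw [Execution.idleCores_eq, Finset.card_filter]
  -- The last idle unit of an attempt: in `E₁` the round or the down-pass ends, in `E₂` the core
  -- resumes work.
  set E₁ := S.filter fun x => x.2 + 1 = T ∨ round (x.2 + 1) ≠ round x.2 with hE₁
  set E₂ := S.filter fun x => X.Working (fun _ => P) x.1 (x.2 + 1) with hE₂
  have hbox : (Finset.univ ×ˢ Finset.range (P.depth + 1) : Finset (Fin p × ℕ)).card =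
      p * (P.depth + 1) := by simp
  have h1 : E₁.card ≤ p * (P.depth + 1) := by
    rw [← hbox]
    refine Finset.card_le_card_of_injOn (fun x => (x.1, round x.2)) ?_ ?_
    · rintro ⟨c, t⟩ hx
      have ht := ((hmem c t).1 (Finset.mem_filter.1 hx).1).1
      simpa [Nat.lt_succ_iff] using hX.round_le ht
    · have key : ∀ {c c' t t'}, (c, t) ∈ E₁ → (c', t') ∈ E₁ → round t = round t' → ¬ t < t' := by
        intro c c' t t' hx hx' hr hlt
        obtain ⟨-, h⟩ := Finset.mem_filter.1 hx
        have ht' := ((hmem c' t').1 (Finset.mem_filter.1 hx').1).1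
        have h2 := hX.round_mono (show t ≤ t + 1 by omega)
        have h3 := hX.round_mono (show t + 1 ≤ t' by omega)
        simp only at h
        omega
      rintro ⟨c, t⟩ hx ⟨c', t'⟩ hx' hxx
      simp only [Prod.mk.injEq] at hxx ⊢
      have h2 := key hx hx' hxx.2
      have h3 := key hx' hx hxx.2.symm
      exact ⟨hxx.1, by omega⟩
  have h2 : E₂.card ≤ p * (P.depth + 1) := by
    rw [← hbox]
    have hst : ∀ x ∈ E₂, ∃ s ∈ P.nodes, X.stolen 0 s = true ∧ X.core 0 s .down = x.1 ∧
        X.start 0 s .down = x.2 + 1 := by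
      rintro ⟨c, t⟩ hx
      obtain ⟨hx, hw⟩ := Finset.mem_filter.1 hx
      obtain ⟨i, s, hs⟩ := Execution.exists_stolen_of_working hP hW
        (fun i => by rw [Fin.fin_one_eq_zero i]; exact hX.root_start) ((hmem c t).1 hx).2 hw
      rw [Fin.fin_one_eq_zero i] at hs
      exact ⟨s, hs⟩
    choose! s hs hstol hcore hstart using hst
    -- A success is charged to the victim, the core that executed the parent, and to the level of
    -- the task.
    refine Finset.card_le_card_of_injOn (fun x => (X.core 0 (s x).tail .down, (s x).length)) ?_ ?_
    · intro x hx
      simpa [Nat.lt_succ_iff] using BP.length_le_depth (hs x hx)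
    · intro x hx y hy hxy
      simp only [Prod.mk.injEq] at hxy
      have hss := hX.eq_of_stolen hP hW (hs x hx) (hs y hy) (hstol x hx) (hstol y hy) hxy.2 hxy.1
      have h3 := hcore x hx
      have h4 := hstart x hx
      rw [hss] at h3 h4
      have h5 := hstart y hy
      exact Prod.ext (h3.symm.trans (hcore y hy)) (by omega)
  -- Otherwise the core would stay idle in one round through `t + sP < T`, against `steal_delay`.
  -- Each such end then accounts for at most `sP` idle units of its core.
  have hend : ∀ x ∈ S, ∃ e, x.2 ≤ e ∧ e < x.2 + sP ∧ (x.1, e) ∈ E₁ ∪ E₂ := by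
    rintro ⟨c, t⟩ hx
    by_contra! hcon
    simp only at hcon
    rw [hmem] at hx
    have key : ∀ m ≤ sP, (t + m < T ∧ ¬ X.Working (fun _ => P) c (t + m)) ∧
        round (t + m) = round t := by
      intro m
      induction m with
      | zero => exact fun _ => ⟨hx, rfl⟩
      | succ m ih =>
        intro hm
        obtain ⟨h3, h4⟩ := ih (by omega)
        have h5 := hcon (t + m) (by omega) (by omega)
        simp only [hE₁, hE₂, Finset.mem_union, Finset.mem_filter, hmem, h3, true_and,
          not_or, not_not, ne_eq, not_false_iff] at h5
        obtain ⟨⟨h6, h7⟩, h8⟩ := h5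
        rw [← add_assoc]
        exact ⟨⟨by omega, h8⟩, h7.trans h4⟩
    have h3 := hX.steal_delay c t fun t' h4 h5 => by
      obtain ⟨m, rfl⟩ := Nat.exists_eq_add_of_le h4
      exact ⟨(key m (by omega)).1.2, (key m (by omega)).2⟩
    have h4 := (key sP le_rfl).1.1
    omega
  choose! e he1 he2 he3 using hend
  have hfin : S.card ≤ sP * (E₁ ∪ E₂).card := by
    refine Finset.card_le_mul_card_image_of_maps_to (f := fun x => (x.1, e x)) he3 sP fun y _ => ?_
    have hIco : (Finset.Ico (y.2 + 1 - sP) (y.2 + 1)).card ≤ sP := by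
      rw [Nat.card_Ico]
      omega
    refine le_trans (Finset.card_le_card_of_injOn Prod.snd ?_ ?_) hIco
    · intro x hx
      obtain ⟨hxS, rfl⟩ := Finset.mem_filter.1 hx
      have h3 := he1 x hxS
      have h4 := he2 x hxS
      simp only [Finset.coe_Ico, Set.mem_Ico]
      omega
    · intro x hx x' hx' hxx
      obtain ⟨-, h3⟩ := Finset.mem_filter.1 hx
      obtain ⟨-, h4⟩ := Finset.mem_filter.1 hx'
      exact Prod.ext ((congrArg Prod.fst h3).trans (congrArg Prod.fst h4).symm) hxx
  rw [hcard]
  refine hfin.trans (Nat.mul_le_mul_left _ ((Finset.card_union_le _ _).trans ?_))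
  omega

end pws

/-! ### Asymptotics -/

theorem one_le_logb_two {n : ℕ} (hn : 2 ≤ n) : 1 ≤ Real.logb 2 n := by
  rw [Real.le_logb_iff_rpow_le (by norm_num) (by positivity)]
  simpa using (by exact_mod_cast hn : (2 : ℝ) ≤ n)

/-- The height of a BP computation is logarithmic in its size. -/
theorem exists_depth_add_one_le {α c₂ : ℝ} (hα₀ : 0 < α) (hα₁ : α < 1) (hc₂ : 1 ≤ c₂) :
    ∃ C : ℝ, 0 < C ∧ ∀ (K : ℕ) (c₁ : ℝ) (P : BP), P.IsBP K α c₁ c₂ → ∀ n : ℕ, P.size [] ≤ n →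
      2 ≤ n → (P.depth : ℝ) + 1 ≤ C * Real.logb 2 n := by
  have hα : 1 < 1 / α := by rw [lt_div_iff₀ hα₀]; linarith
  have ha := Real.log_pos hα
  have hc := Real.log_nonneg hc₂
  have h2 := Real.log_pos one_lt_two
  refine ⟨Real.log c₂ / Real.log (1 / α) + Real.log 2 / Real.log (1 / α) + 1, by positivity,
    fun K c₁ P hP n hPn hn => ?_⟩
  have hℓ := one_le_logb_two hn
  have hn' : (P.size [] : ℝ) ≤ n := by exact_mod_cast hPn
  have h0 : (0 : ℝ) < n := by positivity
  have h1 : (1 / α) ^ P.depth ≤ c₂ * n :=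
    (hP.inv_pow_depth_le hα₀).trans (by gcongr)
  have h3 := Real.log_le_log (by positivity) h1
  rw [Real.log_pow, Real.log_mul (by positivity) h0.ne'] at h3
  have h4 : Real.log n = Real.log 2 * Real.logb 2 n := by
    rw [Real.logb]; field_simp
  have h5 : (P.depth : ℝ) ≤ Real.log c₂ / Real.log (1 / α) +
      Real.log 2 / Real.log (1 / α) * Real.logb 2 n := by
    rw [div_mul_eq_mul_div, ← add_div, le_div_iff₀ ha, ← h4]
    exact h3
  have h6 : Real.log c₂ / Real.log (1 / α) ≤ Real.log c₂ / Real.log (1 / α) * Real.logb 2 n :=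
    le_mul_of_one_le_right (by positivity) hℓ
  linarith

/-- The duration of the up-pass. -/
theorem completion_le_upPassStart_add {k p K B b : ℕ} {α c₁ c₂ : ℝ} {X : Execution k p}
    {P : Fin k → BP} (hP : IsBPCollection P K α c₁ c₂) (hX : X.IsWorkStealing P B b) {D L : ℕ}
    (hD : ∀ i v, (P i).IsLeaf v → (P i).depth < v.length + D) (hL : ∀ i, (P i).depth ≤ L)
    (hB : 1 ≤ B) (hb : 1 ≤ b) :
    X.completion P ≤ X.upPassStart P + (Nat.log 2 B + D + 4) * (K * ((K * B + 1) * b)) +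
      b * ((2 * K + 1) * L + K + 2) := by
  -- `Nat.log 2 B + 1` full levels give more than `B` nodes, `D` keeps clear of the leaves, and one
  -- level is for passing to a child.
  refine Execution.completion_le hP hX (H := Nat.log 2 B + D + 2) (Nat.le_add_right _ _)
    (fun i v hv => ?_) (fun i v hv h => ?_) (fun i v hv h c => ?_) hL hB hb
  · exact (Execution.finish_down_le hP hX hB hb hv).trans
      (Nat.add_le_add_left (Nat.le_mul_of_pos_left _ (by omega)) _)
  · exact Execution.finish_up_le_of_height hP hX hB hb (Nat.log 2 B + D + 2) hv h
  · have hl : false :: v ∈ (P i).nodes := by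
      by_contra hn
      have := hD i v ⟨hv, hn⟩
      omega
    have h1 := (hP.isBP i).two_pow_le_subtreeCard (hD i) (Nat.log 2 B + 1)
      ((hP.isBP i).child_mem c hl) (by simp; omega)
    have h2 := Nat.lt_pow_succ_log_self one_lt_two B
    exact h2.le.trans h1

theorem exists_upPassIdleTime_le (K : ℕ) {α c₁ c₂ : ℝ} (hα₀ : 0 < α) (hα₁ : α < 1)
    (hc₁ : 0 < c₁) (hc₂ : 1 ≤ c₂) :
    ∃ C : ℝ, 0 < C ∧ ∀ (k : ℕ) (P : Fin k → BP), IsBPCollection P K α c₁ c₂ →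
      ∀ (n : ℕ), n = totalSize P → 2 ≤ n →
      ∀ (p B b : ℕ), 1 ≤ B → 1 ≤ b →
      ∀ X : Execution k p, X.IsWorkStealing P B b →
        (X.upPassIdleTime P : ℝ) ≤ C * (b * p * (Real.logb 2 n + B * Real.logb 2 B)) := by
  obtain ⟨A, hA, hdepth⟩ := exists_depth_add_one_le hα₀ hα₁ hc₂
  obtain ⟨D, hD⟩ := pow_unbounded_of_one_lt (K * c₂ / c₁)
    (show 1 < 1 / α by rw [lt_div_iff₀ hα₀]; linarith)
  refine ⟨2 * K ^ 2 * (D + 5) + (2 * K + 1) * A + K + 2, by positivity, ?_⟩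
  intro k P hP n hn hn2 p B b hB hb X hX
  have hℓ := one_le_logb_two hn2
  set ℓ := Real.logb 2 n
  have hdep : ∀ i, ((P i).depth : ℝ) ≤ A * ℓ := by
    intro i
    have := hdepth K c₁ (P i) (hP.isBP i) n
      (hn ▸ Finset.single_le_sum (f := fun i => (P i).size []) (fun _ _ => Nat.zero_le _)
        (Finset.mem_univ i)) hn2
    linarith
  have hcomp := completion_le_upPassStart_add hP hX (D := D) (L := ⌊A * ℓ⌋₊)
    (fun i v hv => (hP.isBP i).depth_lt_of_isLeaf hα₀ hα₁ hc₁ hc₂ hD hv)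
    (fun i => Nat.le_floor (hdep i)) hB hb
  have hidle : X.upPassIdleTime P ≤ p * ((Nat.log 2 B + D + 4) * (K * ((K * B + 1) * b)) +
      b * ((2 * K + 1) * ⌊A * ℓ⌋₊ + K + 2)) :=
    Execution.upPassIdleTime_le.trans (Nat.mul_le_mul_left _ (by omega))
  have hidle' : (X.upPassIdleTime P : ℝ) ≤ p * ((Nat.log 2 B + D + 4) * (K * ((K * B + 1) * b)) +
      b * ((2 * K + 1) * ⌊A * ℓ⌋₊ + K + 2)) := by exact_mod_cast hidle
  have hfloor : (⌊A * ℓ⌋₊ : ℝ) ≤ A * ℓ := Nat.floor_le (by positivity)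
  have hlog : (Nat.log 2 B : ℝ) ≤ Real.logb 2 B := Real.natLog_le_logb B 2
  have hB' : (1 : ℝ) ≤ B := by exact_mod_cast hB
  have hlam : 0 ≤ Real.logb 2 B := Real.logb_nonneg one_lt_two hB'
  -- For `B = 1` the term `B log B` vanishes and `ℓ ≥ 1` pays instead.
  have hBl : (B : ℝ) ≤ B * Real.logb 2 B + ℓ := by
    rcases hB.eq_or_lt with rfl | hB2
    · simpa using hℓ
    · have := one_le_logb_two hB2
      nlinarith
  set lam := Real.logb 2 B
  have hKK : (K : ℝ) * (K * B + 1) ≤ 2 * K ^ 2 * B := by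
    rcases Nat.eq_zero_or_pos K with rfl | hK
    · simp
    · have hK' : (1 : ℝ) ≤ K := by exact_mod_cast hK
      nlinarith [mul_le_mul hK' hB' zero_le_one (by positivity)]
  have hmain : (Nat.log 2 B + D + 4) * (K * (K * B + 1)) + ((2 * K + 1) * ⌊A * ℓ⌋₊ + K + 2) ≤
      (2 * K ^ 2 * (D + 5) + (2 * K + 1) * A + K + 2) * (ℓ + B * lam) := by
    have e1 : (Nat.log 2 B + D + 4 : ℝ) * (K * (K * B + 1)) ≤
        (lam + D + 4) * (2 * K ^ 2 * B) := by gcongr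
    have e2 : (lam + D + 4) * B ≤ (D + 5) * (ℓ + B * lam) := by
      have : (D + 4 : ℝ) * B ≤ (D + 4) * (B * lam + ℓ) := by gcongr
      linarith
    have e3 : (lam + D + 4) * (2 * K ^ 2 * B) ≤ 2 * K ^ 2 * ((D + 5) * (ℓ + B * lam)) := by
      calc (lam + D + 4) * (2 * K ^ 2 * B) = 2 * K ^ 2 * ((lam + D + 4) * B) := by ring
        _ ≤ _ := by gcongr
    have hBlam : 0 ≤ B * lam := by positivity
    have e4 : (2 * K + 1 : ℝ) * ⌊A * ℓ⌋₊ ≤ (2 * K + 1) * (A * (ℓ + B * lam)) := by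
      gcongr
      exact hfloor.trans (by gcongr; linarith)
    have e5 : (K + 2 : ℝ) * 1 ≤ (K + 2) * (ℓ + B * lam) := by
      gcongr
      linarith
    linarith
  calc (X.upPassIdleTime P : ℝ) ≤ _ := hidle'
    _ = b * p * ((Nat.log 2 B + D + 4) * (K * (K * B + 1)) +
        ((2 * K + 1) * ⌊A * ℓ⌋₊ + K + 2)) := by ring
    _ ≤ b * p * ((2 * K ^ 2 * (D + 5) + (2 * K + 1) * A + K + 2) * (ℓ + B * lam)) := by gcongr
    _ = _ := by ring

end PWS

theorem mainTheorem8 (K : ℕ) (α c₁ c₂ : ℝ) (hα₀ : 0 < α) (hα₁ : α < 1)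
    (hc₁ : 0 < c₁) (hc₁' : c₁ ≤ 1) (hc₂ : 1 ≤ c₂) :
    (∃ C : ℝ, 0 < C ∧ ∀ (k : ℕ) (P : Fin k → PWS.BP), PWS.IsBPCollection P K α c₁ c₂ →
      ∀ (n : ℕ), n = PWS.totalSize P → 2 ≤ n →
      ∀ (p B b : ℕ), 1 ≤ B → 1 ≤ b →
      ∀ X : PWS.Execution k p, X.IsWorkStealing P B b →
        (X.upPassIdleTime P : ℝ) ≤ C * (b * p * (Real.logb 2 n + B * Real.logb 2 B))) ∧
    (∀ κ : ℝ, 0 < κ → ∃ C : ℝ, 0 < C ∧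
      ∀ P : PWS.BP, PWS.IsBPCollection (fun _ : Fin 1 => P) K α c₁ c₂ →
      ∀ (n : ℕ), n = P.size [] → 2 ≤ n →
      ∀ (p B b : ℕ), 1 ≤ B → 1 ≤ b →
      ∀ (X : PWS.Execution 1 p) (round : ℕ → ℕ) (sP : ℕ),
        X.IsWorkStealing (fun _ => P) B b → PWS.IsPWS X P round sP → κ * b ≤ sP →
        (X.idleTime (fun _ => P) : ℝ) ≤
          C * (sP * p * Real.logb 2 n) + C * (b * B * p * Real.logb 2 B)) := by
  refine ⟨PWS.exists_upPassIdleTime_le K hα₀ hα₁ hc₁ hc₂, fun κ hκ => ?_⟩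
  obtain ⟨C, hC, hup⟩ := PWS.exists_upPassIdleTime_le K hα₀ hα₁ hc₁ hc₂
  obtain ⟨A, hA, hdepth⟩ := PWS.exists_depth_add_one_le hα₀ hα₁ hc₂
  -- `2 * A` pays for the two kinds of attempt ends, `C / κ` for the term `b p log n` of the up-pass
  -- through `b ≤ sP / κ`, and `C` for its `B log B` term.
  refine ⟨2 * A + C / κ + C, by positivity, ?_⟩
  intro P hP n hn hn2 p B b hB hb X round sP hW hX hs
  have h1 := hup 1 _ hP n (by simpa [PWS.totalSize] using hn) hn2 p B b hB hb X hW
  have h2 : (X.idleTime (fun _ => P) : ℝ) ≤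
      sP * (2 * (p * (P.depth + 1))) + X.upPassIdleTime fun _ => P := by
    exact_mod_cast PWS.Execution.idleTime_le.trans
      (Nat.add_le_add_right (hX.sum_idleCores_le hP hW) _)
  have h3 := hdepth K c₁ P (hP.isBP 0) n hn.ge hn2
  have hℓ := PWS.one_le_logb_two hn2
  have hlam : 0 ≤ Real.logb 2 B := Real.logb_nonneg one_lt_two (by exact_mod_cast hB)
  set ℓ := Real.logb 2 n
  set lam := Real.logb 2 B
  have h4 : (sP * (2 * (p * (P.depth + 1))) : ℝ) ≤ sP * (2 * (p * (A * ℓ))) := by gcongr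
  have h5 : C * (b * p * ℓ) ≤ C / κ * (sP * p * ℓ) := by
    have : (b : ℝ) ≤ sP / κ := by rw [le_div_iff₀ hκ]; linarith
    calc C * (b * p * ℓ) ≤ C * (sP / κ * p * ℓ) := by gcongr
      _ = _ := by ring
  have h6 : 0 ≤ C * (sP * p * ℓ) := by positivity
  have h7 : 0 ≤ (2 * A + C / κ) * (b * B * p * lam) := by positivity
  linarith
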